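/- Call a subset of $\mathbb{C}^N$ Zariski closed if it is the set of common zeros of a family of complex polynomials, and say that a set $Z\subset\mathbb{C}^N$ is defined over $\mathbb{R}$ if the ideal of all polynomials in $\mathbb{C}[x_1,\dots,x_N]$ vanishing on $Z$ is generated by polynomials with real coefficients; put $Z(\mathbb{R})=Z\cap\mathbb{R}^N$. Let $G\subset \mathrm{GL}_n(\mathbb{C})\subset\mathbb{C}^{n^2}$ be an algebraic group, that is, a subgroup which is the set of zeros in $\mathrm{GL}_n(\mathbb{C})$ of a family of complex polynomials in the matrix entries. Assume that $G$ is defined over $\mathbb{R}$ and irreducible, i.e. $G$ is not the union of two proper subsets that are Zariski closed in $\mathrm{GL}_n(\mathbb{C})$. Let $X\subset\mathbb{C}^m$ be a Zariski closed set defined over $\mathbb{R}$, let $x\in X(\mathbb{R})$, and let $G\times X\to X$, $(g,z)\mapsto g\cdot z$, be a polynomial group action defined over $\mathbb{R}$, meaning that the coordinates of $g\cdot z$ are given by polynomials with real coefficients in the entries of $g$, in $\det(g)^{-1}$, and in the coordinates of $z$. Let $Y$ be the Zariski closure of the orbit $G\cdot x$ (in $X$, or equivalently in $\mathbb{C}^m$).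 Then $Y$ is defined over $\mathbb{R}$, and the map $$ G(\mathbb{R})\to Y(\mathbb{R}),\qquad g\mapsto g\cdot x, $$ is open with respect to the Euclidean topologies. -/

import Mathlib

open Matrix

/-- A subset of `ℂ^σ` is (Zariski) closed if it is the zero set of a family of polynomials. -/
def IsZariskiClosed {σ : Type*} (X : Set (σ → ℂ)) : Prop :=
  ∃ I : Set (MvPolynomial σ ℂ), X = {x | ∀ P ∈ I, MvPolynomial.eval x P = 0}

/-- The Zariski closure: the smallest Zariski closed set containing `S`. -/
def zariskiClosure {σ : Type*} (S : Set (σ → ℂ)) : Set (σ → ℂ) :=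
  ⋂₀ {Z | IsZariskiClosed Z ∧ S ⊆ Z}

/-- `X` is defined over `ℝ`: the ideal of all complex polynomials vanishing on `X` is generated
by polynomials with real coefficients. -/
def IsDefinedOverReal {σ : Type*} (X : Set (σ → ℂ)) : Prop :=
  ∃ J : Set (MvPolynomial σ ℝ),
    MvPolynomial.vanishingIdeal ℂ X = Ideal.span (MvPolynomial.map (algebraMap ℝ ℂ) '' J)

/-- The set `X(ℝ) = X ∩ ℝ^σ`, with the topology induced from `ℂ^σ` (equivalently `ℝ^σ`). -/
def realPoints {σ : Type*} (X : Set (σ → ℂ)) : Set (σ → ℂ) :=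
  {z | z ∈ X ∧ ∀ i, z i ∈ Set.range ((↑) : ℝ → ℂ)}

/-- The matrix entries of `g`, as a point of `ℂ^(n × n)`. -/
def matrixEntries {n : ℕ} (g : GL (Fin n) ℂ) : Fin n × Fin n → ℂ :=
  fun p => (g : Matrix (Fin n) (Fin n) ℂ) p.1 p.2

/-- A subset of `GL_n(ℂ)` is (Zariski) closed in `GL_n(ℂ)` if it is the set of zeros in `GL_n(ℂ)`
of a family of polynomials in the matrix entries. -/
def IsZariskiClosedInGL {n : ℕ} (S : Set (GL (Fin n) ℂ)) : Prop :=
  ∃ I : Set (MvPolynomial (Fin n × Fin n) ℂ),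
    S = {g | ∀ P ∈ I, MvPolynomial.eval (matrixEntries g) P = 0}

/-- An algebraic group: a subgroup of `GL_n(ℂ)` which is closed in `GL_n(ℂ)`. -/
def IsAlgebraicGroup {n : ℕ} (G : Subgroup (GL (Fin n) ℂ)) : Prop :=
  IsZariskiClosedInGL (G : Set (GL (Fin n) ℂ))

/-- `G` is irreducible: it is not the union of two proper closed subsets. -/
def IsIrreducibleGroup {n : ℕ} (G : Subgroup (GL (Fin n) ℂ)) : Prop :=
  ∀ S₁ S₂ : Set (GL (Fin n) ℂ), IsZariskiClosedInGL S₁ → IsZariskiClosedInGL S₂ →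
    S₁ ⊂ (G : Set (GL (Fin n) ℂ)) → S₂ ⊂ (G : Set (GL (Fin n) ℂ)) →
      (G : Set (GL (Fin n) ℂ)) ≠ S₁ ∪ S₂

/-- The set `G(ℝ)` of elements of `G` with real matrix entries. It carries the topology induced
from `GL_n(ℂ)`, i.e. the Euclidean topology. -/
def groupRealPoints {n : ℕ} (G : Subgroup (GL (Fin n) ℂ)) : Set G :=
  {g | ∀ p, matrixEntries (g : GL (Fin n) ℂ) p ∈ Set.range ((↑) : ℝ → ℂ)}

/-- The coordinates of `(g, z)` in `GL_n(ℂ) × ℂ^m`: the matrix entries of `g`, the number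
`det(g)⁻¹`, and the coordinates of `z`. -/
noncomputable def actionCoords {n m : ℕ} (g : GL (Fin n) ℂ) (z : Fin m → ℂ) :
    (Fin n × Fin n) ⊕ (Unit ⊕ Fin m) → ℂ :=
  Sum.elim (matrixEntries g)
    (Sum.elim (fun _ => ((g : Matrix (Fin n) (Fin n) ℂ).det)⁻¹) z)

/-- The action map `G × X → X` is polynomial and defined over `ℝ`: it is given by polynomials with
real coefficients in the matrix entries of `g`, in `det(g)⁻¹` and in the coordinates of `z`. -/
def IsRealPolynomialAction {n m : ℕ} (G : Subgroup (GL (Fin n) ℂ)) (X : Set (Fin m → ℂ))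
    [MulAction G X] : Prop :=
  ∃ P : Fin m → MvPolynomial ((Fin n × Fin n) ⊕ (Unit ⊕ Fin m)) ℝ,
    ∀ (g : G) (z : X) (i : Fin m),
      ((g • z : X) : Fin m → ℂ) i =
        MvPolynomial.aeval (actionCoords (g : GL (Fin n) ℂ) (z : Fin m → ℂ)) (P i)

/-- The Zariski closure of the orbit `G · x`. -/
def orbitClosure {n m : ℕ} (G : Subgroup (GL (Fin n) ℂ)) {X : Set (Fin m → ℂ)}
    [MulAction G X] (x : X) : Set (Fin m → ℂ) :=
  zariskiClosure ((fun z : X => (z : Fin m → ℂ)) '' MulAction.orbit G x)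

theorem subset_zariskiClosure {σ : Type*} (S : Set (σ → ℂ)) : S ⊆ zariskiClosure S :=
  Set.subset_sInter fun _ hZ => hZ.2

theorem aeval_mem_range_ofReal {σ : Type*} {z : σ → ℂ}
    (hz : ∀ i, z i ∈ Set.range ((↑) : ℝ → ℂ)) (P : MvPolynomial σ ℝ) :
    MvPolynomial.aeval z P ∈ Set.range ((↑) : ℝ → ℂ) := by
  choose a ha using hz
  obtain rfl : (fun i => (a i : ℂ)) = z := funext ha
  refine ⟨MvPolynomial.eval a P, ?_⟩
  have h := MvPolynomial.aeval_algebraMap_apply ℂ a P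
  simpa [MvPolynomial.aeval_eq_eval, Function.comp_def] using h.symm

theorem det_inv_mem_range_ofReal {n : ℕ} {A : Matrix (Fin n) (Fin n) ℂ}
    (hA : ∀ i j, A i j ∈ Set.range ((↑) : ℝ → ℂ)) :
    (A.det)⁻¹ ∈ Set.range ((↑) : ℝ → ℂ) := by
  choose B hB using hA
  obtain rfl : (Matrix.of B).map (algebraMap ℝ ℂ) = A := by
    ext i j
    exact hB i j
  refine ⟨(Matrix.of B).det⁻¹, ?_⟩
  rw [Complex.ofReal_inv]
  congr 1
  exact RingHom.map_det (algebraMap ℝ ℂ) (Matrix.of B)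

theorem smul_mem_realPoints_orbitClosure {n m : ℕ} {G : Subgroup (GL (Fin n) ℂ)}
    {X : Set (Fin m → ℂ)} [MulAction G X] (hact : IsRealPolynomialAction G X)
    {x : X} (hx : (x : Fin m → ℂ) ∈ realPoints X) {g : G} (hg : g ∈ groupRealPoints G) :
    ((g • x : X) : Fin m → ℂ) ∈ realPoints (orbitClosure G x) := by
  refine ⟨subset_zariskiClosure _ ⟨g • x, ⟨g, rfl⟩, rfl⟩, fun i => ?_⟩
  obtain ⟨P, hP⟩ := hact
  rw [hP]
  refine aeval_mem_range_ofReal ?_ _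
  rintro (p | _ | j)
  · exact hg p
  · exact det_inv_mem_range_ofReal fun i j => hg (i, j)
  · exact hx.2 j

/-- The orbit map `G(ℝ) → Y(ℝ)`, `g ↦ g · x`, where `Y` is the Zariski closure of `G · x`. -/
def realOrbitMap {n m : ℕ} {G : Subgroup (GL (Fin n) ℂ)} {X : Set (Fin m → ℂ)} [MulAction G X]
    (hact : IsRealPolynomialAction G X) (x : X) (hx : (x : Fin m → ℂ) ∈ realPoints X) :
    groupRealPoints G → realPoints (orbitClosure G x) :=
  fun g => ⟨((g : G) • x : X), smul_mem_realPoints_orbitClosure hact hx g.2⟩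

/-! The group, the point `x` and the action polynomials are stable under complex conjugation, hence
so are the orbit and its vanishing ideal. A conjugation-stable ideal contains the real and imaginary
parts of its elements, so the orbit closure `Y` is defined over ℝ.

For openness, translation in the group reduces the claim to the identity, at an arbitrary real point
`x` of the orbit: real points of `Y` near `x` must have the form `u • x` with `u` real and close to
1. In characteristic zero a polynomial map from an irreducible set onto its image has, at some
point, a differential onto the Zariski tangent space of the image (`exists_differential_surjOn`).
Homogeneity moves this point to the identity (`IsActionPolynomial.exists_polyMapDifferential_eq`),
and averaging with the conjugate makes the lifts of real vectors real
(`IsActionPolynomial.exists_realTangent`).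

Tangent vectors at 1 integrate to one-parameter subgroups of `G` (`expGL_smul_mem`). Thus `v ↦ exp v
• x`, on the real Lie algebra, takes values in the zeros of a finite set of generators of the ideal
of `Y`, and its derivative maps onto the common kernel of their differentials. By the inverse
function theorem it then covers all zeros near `x`
(`HasStrictFDerivAt.eventually_exists_eq_of_ker_le_range`); smoothness of `Y` need not be known
beforehand. -/

/-! ### Extending derivations in characteristic zero -/

/-- Formal smoothness as lifting of ring homomorphisms along square-zero extensions. -/
theorem Algebra.FormallySmooth.exists_ringHom_section {L K T : Type*} [CommRing L] [CommRing K]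
    [CommRing T] [Algebra L K] [Algebra.FormallySmooth L K] (π : T →+* K)
    (hπ : Function.Surjective π) (hker : IsNilpotent (RingHom.ker π)) (θ : L →+* T)
    (hθ : π.comp θ = algebraMap L K) :
    ∃ s : K →+* T, π.comp s = RingHom.id K ∧ s.comp (algebraMap L K) = θ := by
  let _ : Algebra L T := θ.toAlgebra
  let g : T →ₐ[L] K := { π with commutes' := fun r => RingHom.congr_fun hθ r }
  let s := Algebra.FormallySmooth.liftOfSurjective (AlgHom.id L K) g hπ hker
  refine ⟨s, RingHom.ext fun a => ?_, RingHom.ext fun a => s.commutes a⟩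
  exact Algebra.FormallySmooth.liftOfSurjective_apply (AlgHom.id L K) g hπ hker a

/-- Over a transcendence basis the extension is algebraic, hence separable in characteristic zero.
-/
theorem Algebra.FormallySmooth.of_field_charZero (L K : Type*) [Field L] [Field K] [Algebra L K]
    [CharZero L] : Algebra.FormallySmooth L K := by
  obtain ⟨s, hs⟩ := exists_isTranscendenceBasis L K
  have := hs.isAlgebraic_field
  exact .of_algebraicIndependent_of_isSeparable hs.1

namespace MvPolynomial

/-- First-order Taylor expansion in the dual numbers `K[ε]`. -/
theorem aeval_inl_add_inr {k K ι : Type*} [CommRing k] [CommRing K] [Algebra k K] [Fintype ι]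
    (y ω : ι → K) (f : MvPolynomial ι k) :
    aeval (fun j => (TrivSqZeroExt.inl (y j) + TrivSqZeroExt.inr (ω j) : TrivSqZeroExt K K)) f =
      TrivSqZeroExt.inl (aeval y f) +
        TrivSqZeroExt.inr (∑ j, aeval y (pderiv j f) * ω j) := by
  classical
  induction f using MvPolynomial.induction_on with
  | C a => ext <;> simp [TrivSqZeroExt.algebraMap_eq_inl']
  | add p q hp hq =>
    rw [map_add, hp, hq]
    ext <;> simp [add_mul, Finset.sum_add_distrib]
  | mul_X p i hp =>
    rw [map_mul, hp, aeval_X]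
    ext
    · simp
    · simp [Derivation.leibniz, add_mul, Finset.sum_add_distrib, pderiv_X, Pi.single_apply,
        apply_ite]
      rw [Finset.sum_mul]
      exact Finset.sum_congr rfl fun _ _ => by ring

/-- In characteristic zero, a derivation prescribed on some elements of a field extension exists
as soon as it is compatible with the algebraic relations between these elements. -/
theorem exists_derivation_apply_eq {k K ι : Type*} [Field k] [Field K] [CharZero k] [Algebra k K]
    [Fintype ι] (y ω : ι → K)
    (h : ∀ f : MvPolynomial ι k, aeval y f = 0 → ∑ j, aeval y (pderiv j f) * ω j = 0) :
    ∃ D : Derivation k K K, ∀ j, D (y j) = ω j := by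
  let Θ : MvPolynomial ι k →ₐ[k] TrivSqZeroExt K K :=
    aeval (fun j => TrivSqZeroExt.inl (y j) + TrivSqZeroExt.inr (ω j))
  let I := RingHom.ker (aeval y : MvPolynomial ι k →ₐ[k] K)
  let B := MvPolynomial ι k ⧸ I
  have : I.IsPrime := RingHom.ker_isPrime _
  let incl : B →ₐ[k] K := Ideal.kerLiftAlg (aeval y : MvPolynomial ι k →ₐ[k] K)
  have hincl : Function.Injective incl := Ideal.kerLiftAlg_injective _
  let _ : Algebra B K := incl.toRingHom.toAlgebra
  have : FaithfulSMul B K := (faithfulSMul_iff_algebraMap_injective B K).2 hincl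
  let L := FractionRing B
  let _ : Algebra L K := FractionRing.liftAlgebra B K
  have : CharZero B := charZero_of_injective_algebraMap (algebraMap k B).injective
  have : CharZero L := charZero_of_injective_algebraMap (IsFractionRing.injective B L)
  have := Algebra.FormallySmooth.of_field_charZero L K
  -- Compatibility with the relations is exactly what lets `y j ↦ y j + ε ω j` descend to `B =
  -- k[y]`.
  let ΘB : B →ₐ[k] TrivSqZeroExt K K := Ideal.Quotient.liftₐ I Θ fun f hf => by
    have hf' : aeval y f = 0 := hf
    simp only [Θ, aeval_inl_add_inr, h f hf', hf']
    simp
  have hfst : ∀ b, TrivSqZeroExt.fst (ΘB b) = algebraMap B K b := by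
    intro b
    obtain ⟨f, rfl⟩ := Ideal.Quotient.mk_surjective b
    change TrivSqZeroExt.fst (Θ f) = aeval y f
    rw [show Θ f = _ from aeval_inl_add_inr y ω f]
    simp
  -- A dual number is a unit as soon as its constant term is, so the map extends to `L = k(y)`.
  have hunit : ∀ b : nonZeroDivisors B, IsUnit (ΘB b) := by
    intro b
    rw [TrivSqZeroExt.isUnit_iff_isUnit_fst, hfst, isUnit_iff_ne_zero]
    exact (map_ne_zero_iff _ hincl).2 (nonZeroDivisors.coe_ne_zero b)
  let θ : L →+* TrivSqZeroExt K K :=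
    IsLocalization.lift (M := nonZeroDivisors B) (g := ΘB.toRingHom) hunit
  let π : TrivSqZeroExt K K →+* K := (TrivSqZeroExt.fstHom k K K).toRingHom
  have hθ : π.comp θ = algebraMap L K := by
    apply IsLocalization.ringHom_ext (nonZeroDivisors B)
    refine RingHom.ext fun b => ?_
    simp only [RingHom.comp_apply, θ, IsLocalization.lift_eq]
    rw [← IsScalarTower.algebraMap_apply B L K]
    exact hfst b
  -- Formal smoothness of `K` over `L` extends it to a section `K → K[ε]`, whose `ε`-component is
  -- the derivation.
  obtain ⟨s, hs, hsθ⟩ := Algebra.FormallySmooth.exists_ringHom_section π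
    (fun a => ⟨TrivSqZeroExt.inl a, rfl⟩)
    ⟨2, TrivSqZeroExt.kerIdeal_sq K K⟩ θ hθ
  have hs1 : ∀ a, (s a).fst = a := fun a => RingHom.congr_fun hs a
  have hsB : ∀ f : MvPolynomial ι k, s (aeval y f) = Θ f := by
    intro f
    have h1 := RingHom.congr_fun hsθ (algebraMap B L (Ideal.Quotient.mk I f))
    rw [RingHom.comp_apply, ← IsScalarTower.algebraMap_apply B L K] at h1
    simp only [θ, IsLocalization.lift_eq] at h1
    exact h1
  let D : Derivation k K K := Derivation.mk'
    { toFun := fun a => (s a).snd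
      map_add' := fun a b => by simp
      map_smul' := fun c a => by
        have := hsB (C c)
        simp only [Θ, aeval_C] at this
        rw [Algebra.smul_def, map_mul, this]
        simp [TrivSqZeroExt.algebraMap_eq_inl', Algebra.smul_def] }
    (fun a b => by simp [hs1, mul_comm])
  refine ⟨D, fun j => ?_⟩
  have := hsB (X j)
  simp only [Θ, aeval_X] at this
  change (s (y j)).snd = ω j
  rw [this]
  simp

end MvPolynomial

/-! ### Zariski tangent spaces and generic smoothness -/

namespace MvPolynomial

theorem derivation_aeval {k K σ : Type*} [CommRing k] [CommRing K] [Algebra k K] [Fintype σ]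
    (D : Derivation k K K) (e : σ → K) (f : MvPolynomial σ k) :
    D (aeval e f) = ∑ i, aeval e (pderiv i f) * D (e i) := by
  classical
  induction f using MvPolynomial.induction_on with
  | C a => simp
  | add p q hp hq => simp [hp, hq, add_mul, Finset.sum_add_distrib]
  | mul_X p i hp =>
    simp only [map_mul, aeval_X, Derivation.leibniz, hp, smul_eq_mul, map_add, add_mul,
      Finset.sum_add_distrib, pderiv_X, Pi.single_apply]
    simp [Finset.mul_sum, apply_ite, mul_assoc]

section

variable {k σ ι : Type*} [Field k]

/-- The differential of a polynomial at a point, as a linear form. -/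
noncomputable def differential [Fintype σ] (f : MvPolynomial σ k) (p : σ → k) :
    (σ → k) →ₗ[k] k :=
  ∑ i, eval p (pderiv i f) • LinearMap.proj i

theorem differential_apply [Fintype σ] (f : MvPolynomial σ k) (p v : σ → k) :
    differential f p v = ∑ i, eval p (pderiv i f) * v i := by
  simp [differential]

/-- The polynomial map with given components. -/
noncomputable def polyMap (φ : ι → MvPolynomial σ k) (p : σ → k) : ι → k :=
  fun j => eval p (φ j)

/-- The Zariski tangent space at `p` of the Zariski closure of `S`. -/
noncomputable def zariskiTangent [Fintype σ] (S : Set (σ → k)) (p : σ → k) :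
    Submodule k (σ → k) :=
  ⨅ f ∈ vanishingIdeal k S, LinearMap.ker (differential f p)

theorem mem_zariskiTangent [Fintype σ] {S : Set (σ → k)} {p v : σ → k} :
    v ∈ zariskiTangent S p ↔ ∀ f ∈ vanishingIdeal k S, differential f p v = 0 := by
  simp [zariskiTangent]

theorem mem_vanishingIdeal_iff_eval {S : Set (σ → k)} {f : MvPolynomial σ k} :
    f ∈ vanishingIdeal k S ↔ ∀ p ∈ S, eval p f = 0 := by
  simp [mem_vanishingIdeal_iff, aeval_eq_eval]

theorem eval_bind₁ (φ : ι → MvPolynomial σ k) (p : σ → k) (h : MvPolynomial ι k) :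
    eval p (bind₁ φ h) = eval (polyMap φ p) h := by
  simp only [eval, eval₂Hom_bind₁]
  rfl

theorem bind₁_mem_vanishingIdeal_iff {φ : ι → MvPolynomial σ k} {S : Set (σ → k)}
    {h : MvPolynomial ι k} :
    bind₁ φ h ∈ vanishingIdeal k S ↔ h ∈ vanishingIdeal k (polyMap φ '' S) := by
  simp [eval_bind₁]

/-- The identity of `K^ι` splits as a projection onto the vectors tangent to all relations between
the `y j`, whose columns are values of derivations, and a combination of differentials of
relations. -/
theorem exists_derivation_add_sum_relations {K : Type*} [Field K] [CharZero k] [Algebra k K]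
    [Fintype ι] [DecidableEq ι] (y : ι → K) :
    ∃ (D : ι → Derivation k K K) (c : ι → MvPolynomial ι k →₀ K),
      (∀ j, ∀ h ∈ (c j).support, aeval y h = 0) ∧
      ∀ j a, (Pi.single a 1 : ι → K) j =
        D a (y j) + ∑ h ∈ (c j).support, c j h * aeval y (pderiv a h) := by
  let ℓ : MvPolynomial ι k → Module.Dual K (ι → K) :=
    fun h => ∑ j, aeval y (pderiv j h) • LinearMap.proj j
  have hℓ : ∀ h w, ℓ h w = ∑ j, aeval y (pderiv j h) * w j := fun h w => by simp [ℓ]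
  let U := Submodule.span K (ℓ '' {h | aeval y h = 0})
  let T := U.dualCoannihilator
  -- `T` is the space of vectors killed by all differentials of relations, and `q` a projection onto
  -- it; the columns of `q` are values of derivations.
  obtain ⟨q, hq⟩ := T.subtype.exists_leftInverse_of_injective (by simp)
  have hder : ∀ c : ι, ∃ D : Derivation k K K, ∀ j, D (y j) = (q (Pi.single c 1) : ι → K) j := by
    intro c
    refine exists_derivation_apply_eq y _ fun f hf => ?_
    have h1 := (q (Pi.single c 1)).2
    rw [Submodule.mem_dualCoannihilator] at h1
    rw [← hℓ f]
    exact h1 _ (Submodule.subset_span ⟨_, hf, rfl⟩)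
  choose D hD using hder
  -- The coordinates of `id - q` vanish on `T`, so by finite-dimensional duality they lie in the
  -- span `U` of the differentials.
  have hann : ∀ j, (LinearMap.proj j : Module.Dual K (ι → K)) ∘ₗ
      (LinearMap.id - T.subtype ∘ₗ q) ∈ U := by
    intro j
    rw [← Subspace.dualCoannihilator_dualAnnihilator_eq (W := U), Submodule.mem_dualAnnihilator]
    intro w hw
    have := LinearMap.congr_fun hq ⟨w, hw⟩
    simp only [LinearMap.comp_apply, LinearMap.id_apply, Submodule.subtype_apply] at this
    simp [this]
  have hann' := fun j => (Finsupp.mem_span_image_iff_linearCombination K).1 (hann j)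
  choose c hcN hc using hann'
  refine ⟨D, c, fun j h hh => (Finsupp.mem_supported K _).1 (hcN j) hh, fun j a => ?_⟩
  have := LinearMap.congr_fun (hc j) (Pi.single a 1)
  simp only [Finsupp.linearCombination_apply, Finsupp.sum, LinearMap.sum_apply,
    LinearMap.smul_apply, hℓ] at this
  simp [Pi.single_apply] at this
  simp [Pi.single_apply, this, hD]

/-- A dominant polynomial map from an irreducible variety generically lifts vector fields: modulo
equations of the source and differentials of equations of the target, a nonzero multiple of each
coordinate vector field is the image of a vector field on the source. -/
theorem exists_vectorField_lift [CharZero k] [Fintype σ] [Fintype ι] [DecidableEq ι]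
    {S : Set (σ → k)} (hS : (vanishingIdeal k S).IsPrime) (φ : ι → MvPolynomial σ k) :
    ∃ g ∉ vanishingIdeal k S, ∃ V : ι → σ → MvPolynomial σ k,
      (∀ a, ∀ f ∈ vanishingIdeal k S, ∑ i, pderiv i f * V a i ∈ vanishingIdeal k S) ∧
      ∀ j, ∃ (H : Finset (MvPolynomial ι k)) (μ : MvPolynomial ι k → MvPolynomial σ k),
        (∀ h ∈ H, h ∈ vanishingIdeal k (polyMap φ '' S)) ∧ ∀ a,
          g * (Pi.single a 1 : ι → MvPolynomial σ k) j - (∑ i, pderiv i (φ j) * V a i +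
            ∑ h ∈ H, μ h * bind₁ φ (pderiv a h)) ∈ vanishingIdeal k S := by
  classical
  set I := vanishingIdeal k S with hI
  let R := MvPolynomial σ k ⧸ I
  let K := FractionRing R
  let mk : MvPolynomial σ k →ₐ[k] R := Ideal.Quotient.mkₐ k I
  let e : σ → K := fun i => algebraMap R K (mk (X i))
  have he : ∀ f, aeval e f = algebraMap R K (mk f) := fun f => by
    have : aeval e = (IsScalarTower.toAlgHom k R K).comp mk := by
      ext i
      simp [e]
    rw [this]
    rfl
  have hzero : ∀ f, aeval e f = 0 ↔ f ∈ I := fun f => by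
    rw [he, map_eq_zero_iff _ (IsFractionRing.injective R K)]
    exact Ideal.Quotient.eq_zero_iff_mem
  let y : ι → K := fun j => aeval e (φ j)
  have hy : ∀ h, aeval y h = aeval e (bind₁ φ h) := fun h => (aeval_bind₁ e φ h).symm
  obtain ⟨D, c, hcN, hid⟩ := exists_derivation_add_sum_relations (k := k) y
  -- All elements of the function field `K` occurring in the splitting of the identity; `s` is a
  -- common denominator, lifted to the polynomial `g`.
  let F : Finset K := Finset.univ.image (fun z : ι × σ => D z.1 (e z.2)) ∪
    Finset.univ.biUnion fun j => (c j).support.image (c j)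
  obtain ⟨s, hs⟩ := IsLocalization.exist_integer_multiples_of_finset (nonZeroDivisors R) F
  have hnum : ∀ a : F, ∃ f : MvPolynomial σ k, aeval e f = algebraMap R K s * a := by
    intro a
    obtain ⟨r, hr⟩ := hs a a.2
    obtain ⟨f, rfl⟩ := Ideal.Quotient.mk_surjective r
    exact ⟨f, by rw [he, ← Algebra.smul_def, ← hr]; rfl⟩
  have hnum' : ∀ a : K, ∃ f : MvPolynomial σ k, a ∈ F → aeval e f = algebraMap R K s * a := by
    intro a
    by_cases ha : a ∈ F
    · obtain ⟨f, hf⟩ := hnum ⟨a, ha⟩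
      exact ⟨f, fun _ => hf⟩
    · exact ⟨0, fun h => absurd h ha⟩
  choose ν hν using hnum'
  obtain ⟨g, hg⟩ := Ideal.Quotient.mk_surjective s.1
  have hg' : aeval e g = algebraMap R K s := by rw [he, ← hg]; rfl
  have hgI : g ∉ I := by
    rw [← Ideal.Quotient.eq_zero_iff_mem, hg]
    exact nonZeroDivisors.coe_ne_zero s
  have hFD : ∀ a i, D a (e i) ∈ F := fun a i =>
    Finset.mem_union_left _ (Finset.mem_image.2 ⟨(a, i), Finset.mem_univ _, rfl⟩)
  have hFc : ∀ j, ∀ h ∈ (c j).support, c j h ∈ F := fun j h hh =>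
    Finset.mem_union_right _ (Finset.mem_biUnion.2
      ⟨j, Finset.mem_univ _, Finset.mem_image_of_mem _ hh⟩)
  refine ⟨g, hgI, fun a i => ν (D a (e i)), fun a f hf => ?_,
    fun j => ⟨(c j).support, fun h => ν (c j h), fun h hh => ?_, fun a => ?_⟩⟩
  · rw [← hzero, map_sum]
    have h1 := derivation_aeval (D a) e f
    rw [(hzero f).2 hf, map_zero] at h1
    calc _ = algebraMap R K s * ∑ i, aeval e (pderiv i f) * D a (e i) := by
          rw [Finset.mul_sum]
          refine Finset.sum_congr rfl fun i _ => ?_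
          rw [map_mul, hν _ (hFD a i)]
          ring
      _ = 0 := by rw [← h1, mul_zero]
  · rw [← bind₁_mem_vanishingIdeal_iff, ← hI, ← hzero, ← hy, hcN j h hh]
  · rw [← hzero, map_sub, sub_eq_zero, map_mul, hg', map_add, map_sum, map_sum]
    have h3 : aeval e ((Pi.single a 1 : ι → MvPolynomial σ k) j) = (Pi.single a 1 : ι → K) j := by
      simp only [Pi.single_apply]; split_ifs <;> simp
    rw [h3, hid, derivation_aeval, mul_add, Finset.mul_sum, Finset.mul_sum]
    congr 1
    · refine Finset.sum_congr rfl fun i _ => ?_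
      rw [map_mul, hν _ (hFD a i)]
      ring
    · refine Finset.sum_congr rfl fun h hh => ?_
      rw [map_mul, hν _ (hFc j h hh), hy]
      ring

/-- Generic smoothness over a field of characteristic zero: a polynomial map from an irreducible
set to its image is a submersion at some point. -/
theorem exists_differential_surjOn [CharZero k] [Fintype σ] [Fintype ι] {S : Set (σ → k)}
    (hS : (vanishingIdeal k S).IsPrime) (φ : ι → MvPolynomial σ k) :
    ∃ p ∈ S, ∀ w ∈ zariskiTangent (polyMap φ '' S) (polyMap φ p),
      ∃ v ∈ zariskiTangent S p, ∀ j, differential (φ j) p v = w j := by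
  classical
  obtain ⟨g, hgI, V, hV, hφ⟩ := exists_vectorField_lift hS φ
  choose H μ hH hφ using hφ
  -- Where the common denominator is nonzero, the identity over the function field specializes to
  -- `p`; the relation terms vanish on tangent vectors `w`.
  obtain ⟨p, hp, hgp⟩ : ∃ p ∈ S, eval p g ≠ 0 := by
    by_contra! hcon
    exact hgI (mem_vanishingIdeal_iff_eval.2 hcon)
  have htan : ∀ a, ∀ f ∈ vanishingIdeal k S, ∑ i, eval p (pderiv i f) * eval p (V a i) = 0 := by
    intro a f hf
    simpa using mem_vanishingIdeal_iff_eval.1 (hV a f hf) p hp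
  have hidp : ∀ j a, eval p g * (Pi.single a 1 : ι → k) j =
      ∑ i, eval p (pderiv i (φ j)) * eval p (V a i) +
        ∑ h ∈ H j, eval p (μ j h) * eval (polyMap φ p) (pderiv a h) := by
    intro j a
    have h3 : eval p ((Pi.single a 1 : ι → MvPolynomial σ k) j) = (Pi.single a 1 : ι → k) j := by
      simp only [Pi.single_apply]; split_ifs <;> simp
    simpa [sub_eq_zero, h3, eval_bind₁] using mem_vanishingIdeal_iff_eval.1 (hφ j a) p hp
  refine ⟨p, hp, fun w hw => ⟨fun i => (eval p g)⁻¹ * ∑ a, eval p (V a i) * w a, ?_, ?_⟩⟩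
  · rw [mem_zariskiTangent]
    intro f hf
    rw [differential_apply]
    calc _ = (eval p g)⁻¹ * ∑ a, (∑ i, eval p (pderiv i f) * eval p (V a i)) * w a := by
          simp only [Finset.mul_sum, Finset.sum_mul]
          rw [Finset.sum_comm]
          refine Finset.sum_congr rfl fun a _ => Finset.sum_congr rfl fun i _ => by ring
      _ = 0 := by simp [htan _ f hf]
  · intro j
    rw [differential_apply]
    have h5 : ∀ h ∈ H j, ∑ a, eval (polyMap φ p) (pderiv a h) * w a = 0 := fun h hh => by
      rw [← differential_apply]
      exact mem_zariskiTangent.1 hw _ (hH j h hh)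
    calc _ = (eval p g)⁻¹ * ∑ a, (∑ i, eval p (pderiv i (φ j)) * eval p (V a i)) * w a := by
          simp only [Finset.mul_sum, Finset.sum_mul]
          rw [Finset.sum_comm]
          refine Finset.sum_congr rfl fun a _ => Finset.sum_congr rfl fun i _ => by ring
      _ = (eval p g)⁻¹ * ∑ a, (eval p g * (Pi.single a 1 : ι → k) j -
            ∑ h ∈ H j, eval p (μ j h) * eval (polyMap φ p) (pderiv a h)) * w a := by
          congr 1
          exact Finset.sum_congr rfl fun a _ => by rw [hidp]; ring
      _ = (eval p g)⁻¹ * (eval p g * w j - ∑ h ∈ H j, eval p (μ j h) *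
            ∑ a, eval (polyMap φ p) (pderiv a h) * w a) := by
          congr 1
          simp only [sub_mul, Finset.sum_sub_distrib]
          congr 1
          · simp [Pi.single_apply]
          · simp only [Finset.mul_sum, Finset.sum_mul]
            rw [Finset.sum_comm]
            refine Finset.sum_congr rfl fun a _ => Finset.sum_congr rfl fun i _ => by ring
      _ = w j := by
          rw [Finset.sum_eq_zero fun h hh => by rw [h5 h hh, mul_zero]]
          simp [hgp]

end

end MvPolynomial

/-! ### Chain rule for polynomial maps -/

namespace MvPolynomial

section

variable {k σ τ ι : Type*} [Field k] [Fintype σ] [Fintype τ]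

@[simp]
theorem differential_C (a : k) (p v : σ → k) : differential (C a) p v = 0 := by
  simp [differential_apply]

@[simp]
theorem differential_X (i : σ) (p v : σ → k) : differential (X i) p v = v i := by
  classical
  simp [differential_apply, pderiv_X, Pi.single_apply, apply_ite]

@[simp]
theorem differential_add (f g : MvPolynomial σ k) (p v : σ → k) :
    differential (f + g) p v = differential f p v + differential g p v := by
  simp [differential_apply, add_mul, Finset.sum_add_distrib]

@[simp]
theorem differential_sub (f g : MvPolynomial σ k) (p v : σ → k) :
    differential (f - g) p v = differential f p v - differential g p v := by
  simp [differential_apply, sub_mul, Finset.sum_sub_distrib]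

@[simp]
theorem differential_mul (f g : MvPolynomial σ k) (p v : σ → k) :
    differential (f * g) p v =
      eval p f * differential g p v + eval p g * differential f p v := by
  simp [differential_apply, add_mul, Finset.sum_add_distrib, Finset.mul_sum, mul_assoc]

@[simp]
theorem differential_sum {α : Type*} (s : Finset α) (f : α → MvPolynomial σ k) (p v : σ → k) :
    differential (∑ a ∈ s, f a) p v = ∑ a ∈ s, differential (f a) p v := by
  classical
  induction s using Finset.induction_on with
  | empty => simpa using differential_C (0 : k) p v
  | insert a s ha ih => simp [Finset.sum_insert ha, ih]

/-- The differential of a polynomial map. -/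
noncomputable def polyMapDifferential (φ : ι → MvPolynomial σ k) (p : σ → k) :
    (σ → k) →ₗ[k] (ι → k) :=
  LinearMap.pi fun j => differential (φ j) p

@[simp]
theorem polyMapDifferential_apply (φ : ι → MvPolynomial σ k) (p v : σ → k) (j : ι) :
    polyMapDifferential φ p v j = differential (φ j) p v := rfl

theorem differential_bind₁ (φ : τ → MvPolynomial σ k) (h : MvPolynomial τ k) (p v : σ → k) :
    differential (bind₁ φ h) p v =
      differential h (polyMap φ p) (polyMapDifferential φ p v) := by
  induction h using MvPolynomial.induction_on with
  | C a => simp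
  | add f g hf hg => simp [hf, hg]
  | mul_X f i hf =>
    simp only [map_mul, bind₁_X_right, differential_mul, hf, eval_bind₁, differential_X, eval_X]
    rfl

theorem polyMap_bind₁ {α β : Type*} (ψ : ι → MvPolynomial β k) (φ : β → MvPolynomial α k)
    (p : α → k) :
    polyMap (fun i => bind₁ φ (ψ i)) p = polyMap ψ (polyMap φ p) := by
  ext i
  simp only [polyMap, eval_bind₁]

theorem polyMapDifferential_bind₁ (ψ : ι → MvPolynomial τ k) (φ : τ → MvPolynomial σ k)
    (p v : σ → k) :
    polyMapDifferential (fun i => bind₁ φ (ψ i)) p v =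
      polyMapDifferential ψ (polyMap φ p) (polyMapDifferential φ p v) := by
  ext i
  simp only [polyMapDifferential_apply, differential_bind₁]

theorem polyMapDifferential_mem_zariskiTangent {φ : τ → MvPolynomial σ k} {S : Set (σ → k)}
    {S' : Set (τ → k)} (hφ : Set.MapsTo (polyMap φ) S S') {p v : σ → k}
    (hv : v ∈ zariskiTangent S p) :
    polyMapDifferential φ p v ∈ zariskiTangent S' (polyMap φ p) := by
  rw [mem_zariskiTangent] at hv ⊢
  intro f hf
  rw [← differential_bind₁]
  refine hv _ ?_
  rw [mem_vanishingIdeal_iff_eval] at hf ⊢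
  intro q hq
  rw [eval_bind₁]
  exact hf _ (hφ hq)

/-- This allows differentiating identities that hold only on the group or on an orbit, not on the
ambient space. -/
theorem polyMapDifferential_eq_of_eqOn {φ ψ : ι → MvPolynomial σ k} {S : Set (σ → k)}
    (h : Set.EqOn (polyMap φ) (polyMap ψ) S) {p v : σ → k} (hv : v ∈ zariskiTangent S p) :
    polyMapDifferential φ p v = polyMapDifferential ψ p v := by
  funext j
  rw [mem_zariskiTangent] at hv
  have h1 := hv (φ j - ψ j) (by
    rw [mem_vanishingIdeal_iff_eval]
    intro q hq
    rw [map_sub, sub_eq_zero]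
    exact congrFun (h hq) j)
  rwa [differential_sub, sub_eq_zero] at h1

end

/-! ### Complex derivatives and conjugation -/

section Complex

variable {σ ι : Type*} [Fintype σ]

theorem hasStrictFDerivAt_eval (f : MvPolynomial σ ℂ) (p : σ → ℂ) :
    HasStrictFDerivAt (fun z => eval z f) (LinearMap.toContinuousLinearMap (differential f p)) p := by
  induction f using MvPolynomial.induction_on with
  | C a =>
    have h := hasStrictFDerivAt_const (𝕜 := ℂ) a p
    simp only [eval_C]
    convert! h
    ext v
    simp
  | add f g hf hg =>
    simp only [map_add]
    convert! hf.add hg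
    ext v
    simp
  | mul_X f i hf =>
    simp only [map_mul, eval_X]
    convert! hf.mul ((ContinuousLinearMap.proj (R := ℂ) (φ := fun _ : σ => ℂ) i).hasStrictFDerivAt (x := p))
    ext v
    simp

theorem hasStrictFDerivAt_polyMap [Fintype ι] (φ : ι → MvPolynomial σ ℂ) (p : σ → ℂ) :
    HasStrictFDerivAt (polyMap φ)
      (LinearMap.toContinuousLinearMap (polyMapDifferential φ p)) p := by
  have h : HasStrictFDerivAt (fun x i => eval x (φ i)) (ContinuousLinearMap.pi fun i =>
      LinearMap.toContinuousLinearMap (differential (φ i) p)) p :=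
    hasStrictFDerivAt_pi.2 fun i => hasStrictFDerivAt_eval (φ i) p
  exact h

/-- An equation of `S` is constantly zero along the curve, so its differential kills the velocity.
-/
theorem deriv_mem_zariskiTangent {S : Set (σ → ℂ)} {c : ℂ → σ → ℂ} {c' : σ → ℂ} {t : ℂ}
    (hc : HasDerivAt c c' t) (hS : ∀ s, c s ∈ S) : c' ∈ zariskiTangent S (c t) := by
  rw [mem_zariskiTangent]
  intro f hf
  have h1 := (hasStrictFDerivAt_eval f (c t)).hasFDerivAt.comp_hasDerivAt t hc
  have h2 : (fun z => eval z f) ∘ c = fun _ => 0 := by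
    ext s
    exact mem_vanishingIdeal_iff_eval.1 hf _ (hS s)
  rw [h2, LinearMap.coe_toContinuousLinearMap'] at h1
  exact h1.unique (hasDerivAt_const t 0)

theorem eval_star_map_conj {κ : Type*} (f : MvPolynomial κ ℂ) (p : κ → ℂ) :
    eval (star p) (map (starRingEnd ℂ) f) = starRingEnd ℂ (eval p f) := by
  rw [eval_map, eval, coe_eval₂Hom, hom_eval₂]
  rfl

theorem differential_star_map_conj (f : MvPolynomial σ ℂ) (p v : σ → ℂ) :
    differential (map (starRingEnd ℂ) f) (star p) (star v) =
      starRingEnd ℂ (differential f p v) := by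
  simp only [differential_apply, pderiv_map, eval_star_map_conj, map_sum, map_mul]
  rfl

theorem map_conj_mem_vanishingIdeal {κ : Type*} {S : Set (κ → ℂ)} (hS : ∀ p ∈ S, star p ∈ S)
    {f : MvPolynomial κ ℂ} (hf : f ∈ vanishingIdeal ℂ S) :
    map (starRingEnd ℂ) f ∈ vanishingIdeal ℂ S := by
  rw [mem_vanishingIdeal_iff_eval] at hf ⊢
  intro p hp
  rw [← star_star p, eval_star_map_conj, hf _ (hS p hp), map_zero]

theorem star_mem_zariskiTangent {S : Set (σ → ℂ)} (hS : ∀ p ∈ S, star p ∈ S) {p v : σ → ℂ}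
    (hv : v ∈ zariskiTangent S p) : star v ∈ zariskiTangent S (star p) := by
  rw [mem_zariskiTangent] at hv ⊢
  intro f hf
  have h := differential_star_map_conj (map (starRingEnd ℂ) f) p v
  rw [map_map, show (starRingEnd ℂ).comp (starRingEnd ℂ) = RingHom.id ℂ by ext; simp, map_id,
    hv _ (map_conj_mem_vanishingIdeal hS hf), map_zero] at h
  exact h

end Complex

theorem exists_map_add_C_I_mul_map {σ : Type*} (f : MvPolynomial σ ℂ) :
    ∃ a b : MvPolynomial σ ℝ,
      f = map (algebraMap ℝ ℂ) a + C Complex.I * map (algebraMap ℝ ℂ) b := by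
  induction f using MvPolynomial.induction_on with
  | C z =>
    refine ⟨C z.re, C z.im, ?_⟩
    rw [map_C, map_C, ← C_mul, ← C_add]
    congr 1
    simpa [mul_comm] using (Complex.re_add_im z).symm
  | add p q hp hq =>
    obtain ⟨a, b, rfl⟩ := hp
    obtain ⟨c, d, rfl⟩ := hq
    exact ⟨a + c, b + d, by simp only [map_add]; ring⟩
  | mul_X p i hp =>
    obtain ⟨a, b, rfl⟩ := hp
    exact ⟨a * X i, b * X i, by simp only [map_mul, map_X]; ring⟩

theorem map_conj_map_ofReal {σ : Type*} (a : MvPolynomial σ ℝ) :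
    map (starRingEnd ℂ) (map (algebraMap ℝ ℂ) a) = map (algebraMap ℝ ℂ) a := by
  rw [map_map]
  congr 2
  ext
  simp

/-- An ideal of complex polynomials stable under complex conjugation is generated by real
polynomials. -/
theorem exists_eq_span_map_of_conj_mem {σ : Type*} (I : Ideal (MvPolynomial σ ℂ))
    (hI : ∀ f ∈ I, map (starRingEnd ℂ) f ∈ I) :
    ∃ J : Set (MvPolynomial σ ℝ), I = Ideal.span (map (algebraMap ℝ ℂ) '' J) := by
  refine ⟨{p | map (algebraMap ℝ ℂ) p ∈ I}, le_antisymm (fun f hf => ?_) ?_⟩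
  · obtain ⟨a, b, rfl⟩ := exists_map_add_C_I_mul_map f
    have hf' := hI _ hf
    simp only [map_add, map_mul, map_C, map_conj_map_ofReal, Complex.conj_I] at hf'
    have h2 : (C (1 / 2 : ℂ) * 2 : MvPolynomial σ ℂ) = 1 := by
      rw [← map_ofNat C 2, ← C_mul]
      norm_num
    have hII : (C Complex.I * C Complex.I : MvPolynomial σ ℂ) = -1 := by
      rw [← C_mul]
      simp
    -- With `f̄` the conjugate of `f`, the real part is `(f + f̄) / 2` and the imaginary part `-i (f
    -- - a)`.
    have ha : map (algebraMap ℝ ℂ) a ∈ I := by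
      have h := I.mul_mem_left (C (1 / 2)) (I.add_mem hf hf')
      convert h using 1
      rw [C_neg]
      linear_combination (-map (algebraMap ℝ ℂ) a) * h2
    have hb : map (algebraMap ℝ ℂ) b ∈ I := by
      have h := I.mul_mem_left (-C Complex.I) (I.sub_mem hf ha)
      convert h using 1
      linear_combination (map (algebraMap ℝ ℂ) b) * hII
    exact Ideal.add_mem _ (Ideal.subset_span ⟨a, ha, rfl⟩)
      (Ideal.mul_mem_left _ _ (Ideal.subset_span ⟨b, hb, rfl⟩))
  · rw [Ideal.span_le]
    rintro _ ⟨p, hp, rfl⟩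
    exact hp

end MvPolynomial

open MvPolynomial

/-! ### The group as an affine variety, and invariant vector fields -/

section GroupCoordinates

variable {n m : ℕ}

/-- The affine variety of all coordinates `(g, det(g)⁻¹, x)` with `g ∈ G`. -/
def groupCoords (G : Subgroup (GL (Fin n) ℂ)) (x : Fin m → ℂ) :
    Set ((Fin n × Fin n) ⊕ (Unit ⊕ Fin m) → ℂ) :=
  Set.range fun g : G => actionCoords (g : GL (Fin n) ℂ) x

/-- The generic determinant. -/
noncomputable def detPolynomial (n : ℕ) : MvPolynomial (Fin n × Fin n) ℂ :=
  (Matrix.mvPolynomialX (Fin n) (Fin n) ℂ).det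

theorem eval_detPolynomial (g : GL (Fin n) ℂ) :
    eval (matrixEntries g) (detPolynomial n) = (g : Matrix (Fin n) (Fin n) ℂ).det := by
  rw [detPolynomial, RingHom.map_det]
  congr 1
  ext i j
  simp [matrixEntries]

theorem det_ne_zero (g : GL (Fin n) ℂ) : (g : Matrix (Fin n) (Fin n) ℂ).det ≠ 0 :=
  ((Matrix.isUnit_iff_isUnit_det _).1 g.isUnit).ne_zero

/-- Clearing denominators in a polynomial function of `(g, det(g)⁻¹, x)`. -/
theorem exists_eval_actionCoords_mul_det_pow (x : Fin m → ℂ)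
    (f : MvPolynomial ((Fin n × Fin n) ⊕ (Unit ⊕ Fin m)) ℂ) :
    ∃ (F : MvPolynomial (Fin n × Fin n) ℂ) (N : ℕ), ∀ g : GL (Fin n) ℂ,
      eval (actionCoords g x) f * (g : Matrix (Fin n) (Fin n) ℂ).det ^ N =
        eval (matrixEntries g) F := by
  induction f using MvPolynomial.induction_on with
  | C a => exact ⟨C a, 0, fun g => by simp⟩
  | add p q hp hq =>
    obtain ⟨F, N, hF⟩ := hp
    obtain ⟨F', N', hF'⟩ := hq
    refine ⟨F * detPolynomial n ^ N' + F' * detPolynomial n ^ N, N + N', fun g => ?_⟩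
    simp only [map_add, map_mul, map_pow, eval_detPolynomial, ← hF, ← hF']
    ring
  | mul_X p i hp =>
    obtain ⟨F, N, hF⟩ := hp
    rcases i with i | _ | i
    · refine ⟨F * X i, N, fun g => ?_⟩
      simp only [map_mul, eval_X, ← hF]
      simp only [actionCoords, Sum.elim_inl]
      ring
    · refine ⟨F, N + 1, fun g => ?_⟩
      simp only [map_mul, eval_X, ← hF]
      simp only [actionCoords, Sum.elim_inl, Sum.elim_inr]
      have := det_ne_zero g
      field_simp
      ring
    · refine ⟨F * C (x i), N, fun g => ?_⟩
      simp only [map_mul, eval_X, eval_C, ← hF]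
      simp only [actionCoords, Sum.elim_inr]
      ring

theorem IsAlgebraicGroup.isZariskiClosedInGL_inter {G : Subgroup (GL (Fin n) ℂ)}
    (hG : IsAlgebraicGroup G) (F : MvPolynomial (Fin n × Fin n) ℂ) :
    IsZariskiClosedInGL {g | g ∈ G ∧ eval (matrixEntries g) F = 0} := by
  obtain ⟨I, hI⟩ := hG
  refine ⟨insert F I, ?_⟩
  ext g
  have : g ∈ G ↔ ∀ P ∈ I, eval (matrixEntries g) P = 0 := by
    rw [← SetLike.mem_coe, hI]
    rfl
  simp [this, and_comm]

/-- Multiplying by a power of the determinant turns a polynomial in `(g, det(g)⁻¹, x)` into one in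
the entries with the same zeros on `GL_n`; two factors then split `G` into closed subsets. -/
theorem vanishingIdeal_groupCoords_isPrime {G : Subgroup (GL (Fin n) ℂ)}
    (hG : IsAlgebraicGroup G) (hGirr : IsIrreducibleGroup G) (x : Fin m → ℂ) :
    (vanishingIdeal ℂ (groupCoords G x)).IsPrime := by
  have hmem : ∀ f, f ∈ vanishingIdeal ℂ (groupCoords G x) ↔
      ∀ g ∈ G, eval (actionCoords g x) f = 0 := by
    intro f
    simp [groupCoords]
  constructor
  · rw [Ne, Ideal.eq_top_iff_one, hmem]
    intro h
    simpa using h 1 G.one_mem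
  · intro f h hfh
    obtain ⟨F, N, hF⟩ := exists_eval_actionCoords_mul_det_pow x f
    obtain ⟨H, N', hH⟩ := exists_eval_actionCoords_mul_det_pow x h
    have hzero : ∀ (f : MvPolynomial ((Fin n × Fin n) ⊕ (Unit ⊕ Fin m)) ℂ) F N,
        (∀ g : GL (Fin n) ℂ, eval (actionCoords g x) f *
          (g : Matrix (Fin n) (Fin n) ℂ).det ^ N = eval (matrixEntries g) F) →
        ∀ g : GL (Fin n) ℂ, eval (matrixEntries g) F = 0 ↔ eval (actionCoords g x) f = 0 := by
      intro f F N hF g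
      rw [← hF]
      simp [det_ne_zero g]
    have hunion : (G : Set (GL (Fin n) ℂ)) = {g | g ∈ G ∧ eval (matrixEntries g) F = 0} ∪
        {g | g ∈ G ∧ eval (matrixEntries g) H = 0} := by
      ext g
      simp only [SetLike.mem_coe, Set.mem_union, Set.mem_ofPred_eq, ← and_or_left,
        hzero f F N hF, hzero h H N' hH]
      refine ⟨fun hg => ⟨hg, ?_⟩, fun hg => hg.1⟩
      simpa using (hmem _).1 hfh g hg
    rw [hmem, hmem]
    by_contra! hcon
    obtain ⟨⟨g, hg, hgf⟩, ⟨g', hg', hgh⟩⟩ := hcon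
    refine hGirr _ _ (hG.isZariskiClosedInGL_inter F) (hG.isZariskiClosedInGL_inter H)
      ⟨fun _ h => h.1, fun h => ?_⟩ ⟨fun _ h => h.1, fun h => ?_⟩ hunion
    · exact hgf ((hzero f F N hF g).1 (h hg).2)
    · exact hgh ((hzero _ H N' hH g').1 (h hg').2)

/-- Left translation by `h` in the coordinates `(g, det(g)⁻¹, x)`. -/
noncomputable def leftTranslation (h : GL (Fin n) ℂ) :
    (Fin n × Fin n) ⊕ (Unit ⊕ Fin m) → MvPolynomial ((Fin n × Fin n) ⊕ (Unit ⊕ Fin m)) ℂ :=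
  Sum.elim (fun p => ∑ k, C ((h : Matrix (Fin n) (Fin n) ℂ) p.1 k) * X (Sum.inl (k, p.2)))
    (Sum.elim (fun _ => C ((h : Matrix (Fin n) (Fin n) ℂ).det⁻¹) * X (Sum.inr (Sum.inl ())))
      fun i => X (Sum.inr (Sum.inr i)))

theorem polyMap_leftTranslation (h g : GL (Fin n) ℂ) (x : Fin m → ℂ) :
    polyMap (leftTranslation h) (actionCoords g x) = actionCoords (h * g) x := by
  ext i
  rcases i with i | _ | i
  · simp [polyMap, leftTranslation, actionCoords, matrixEntries, Matrix.mul_apply]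
  · simp [polyMap, leftTranslation, actionCoords, mul_comm]
  · simp [polyMap, leftTranslation, actionCoords]

theorem mapsTo_leftTranslation {G : Subgroup (GL (Fin n) ℂ)} {h : GL (Fin n) ℂ} (hh : h ∈ G)
    (x : Fin m → ℂ) :
    Set.MapsTo (polyMap (leftTranslation h)) (groupCoords G x) (groupCoords G x) := by
  rintro _ ⟨g, rfl⟩
  exact ⟨⟨h, hh⟩ * g, (polyMap_leftTranslation h g x).symm⟩

/-- The matrix part of a vector tangent to the variety of group coordinates. -/
def matrixPart (v : (Fin n × Fin n) ⊕ (Unit ⊕ Fin m) → ℂ) : Matrix (Fin n) (Fin n) ℂ :=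
  Matrix.of fun i j => v (Sum.inl (i, j))

theorem differential_rename_inl {k σ τ : Type*} [Field k] [Fintype σ] [Fintype τ]
    (F : MvPolynomial σ k) (p v : σ ⊕ τ → k) :
    differential (rename Sum.inl F) p v = differential F (p ∘ Sum.inl) (v ∘ Sum.inl) := by
  induction F using MvPolynomial.induction_on with
  | C a => simp
  | add f g hf hg => simp [hf, hg]
  | mul_X f i hf => simp [hf, eval_rename]

/-- The left-invariant vector field `g ↦ g * A`. -/
noncomputable def invariantField (A : Matrix (Fin n) (Fin n) ℂ)
    (F : MvPolynomial (Fin n × Fin n) ℂ) : MvPolynomial (Fin n × Fin n) ℂ :=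
  ∑ p, pderiv p F * ∑ k, X (p.1, k) * C (A k p.2)

theorem eval_invariantField (A B : Matrix (Fin n) (Fin n) ℂ)
    (F : MvPolynomial (Fin n × Fin n) ℂ) :
    eval (fun p => B p.1 p.2) (invariantField A F) =
      differential F (fun p => B p.1 p.2) (fun p => (B * A) p.1 p.2) := by
  simp [invariantField, differential_apply, Matrix.mul_apply]

/-- Left translation by `g ∈ G` carries a tangent vector `A` at 1 to the tangent vector `g * A` at
`g`. -/
theorem invariantField_mem {G : Subgroup (GL (Fin n) ℂ)} {x : Fin m → ℂ}
    {v : (Fin n × Fin n) ⊕ (Unit ⊕ Fin m) → ℂ}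
    (hv : v ∈ zariskiTangent (groupCoords G x) (actionCoords 1 x))
    {F : MvPolynomial (Fin n × Fin n) ℂ}
    (hF : F ∈ vanishingIdeal ℂ (matrixEntries '' (G : Set (GL (Fin n) ℂ)))) :
    invariantField (matrixPart v) F ∈
      vanishingIdeal ℂ (matrixEntries '' (G : Set (GL (Fin n) ℂ))) := by
  rw [mem_vanishingIdeal_iff_eval] at hF ⊢
  rintro _ ⟨g, hg, rfl⟩
  have h1 := polyMapDifferential_mem_zariskiTangent (mapsTo_leftTranslation hg x) hv
  rw [polyMap_leftTranslation, mul_one, mem_zariskiTangent] at h1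
  have h2 := h1 (rename Sum.inl F) (by
    rw [mem_vanishingIdeal_iff_eval]
    rintro _ ⟨g, rfl⟩
    rw [eval_rename]
    exact hF _ ⟨g, g.2, rfl⟩)
  rw [differential_rename_inl] at h2
  refine (eval_invariantField (matrixPart v) (g : Matrix (Fin n) (Fin n) ℂ) F).trans ?_
  rw [← h2]
  congr 1
  ext p
  simp [leftTranslation, Matrix.mul_apply, matrixPart]

end GroupCoordinates

/-! ### One-parameter subgroups -/

section Exponential

open NormedSpace

variable {n m : ℕ}

/-- The exponential of a matrix as an element of the general linear group. -/
noncomputable def expGL (A : Matrix (Fin n) (Fin n) ℂ) : GL (Fin n) ℂ where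
  val := exp A
  inv := exp (-A)
  val_inv := by
    rw [← Matrix.exp_add_of_commute _ _ (Commute.neg_right (Commute.refl A)), add_neg_cancel,
      exp_zero]
  inv_val := by
    rw [← Matrix.exp_add_of_commute _ _ (Commute.neg_left (Commute.refl A)), neg_add_cancel,
      exp_zero]

theorem expGL_zero : expGL (0 : Matrix (Fin n) (Fin n) ℂ) = 1 := by
  ext1
  simp [expGL]

attribute [local instance] Matrix.linftyOpNormedRing Matrix.linftyOpNormedAlgebra

/-- The matrix entries as a continuous linear map. -/
noncomputable def entriesCLM (n : ℕ) :
    Matrix (Fin n) (Fin n) ℂ →L[ℂ] (Fin n × Fin n → ℂ) :=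
  LinearMap.toContinuousLinearMap
    { toFun := fun A p => A p.1 p.2
      map_add' := fun _ _ => rfl
      map_smul' := fun _ _ => rfl }

theorem hasDerivAt_matrixEntries_expGL (A : Matrix (Fin n) (Fin n) ℂ) (s : ℂ) :
    HasDerivAt (fun s : ℂ => matrixEntries (expGL (s • A)))
      (fun p => ((expGL (s • A) : Matrix (Fin n) (Fin n) ℂ) * A) p.1 p.2) s :=
  (entriesCLM n).hasFDerivAt.comp_hasDerivAt s (hasDerivAt_exp_smul_const A s)

/-- For `F` in the ideal of `G`, differentiating the entire function `s ↦ F (exp (s A))` replaces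
`F` by its invariant derivative, again in the ideal. So all derivatives at 0 vanish, and so does the
function. -/
theorem expGL_smul_mem {G : Subgroup (GL (Fin n) ℂ)} (hG : IsAlgebraicGroup G) {x : Fin m → ℂ}
    {v : (Fin n × Fin n) ⊕ (Unit ⊕ Fin m) → ℂ}
    (hv : v ∈ zariskiTangent (groupCoords G x) (actionCoords 1 x)) (s : ℂ) :
    expGL (s • matrixPart v) ∈ G := by
  set A := matrixPart v with hA
  set I := vanishingIdeal ℂ (matrixEntries '' (G : Set (GL (Fin n) ℂ))) with hI
  have hderiv : ∀ F : MvPolynomial (Fin n × Fin n) ℂ, ∀ s : ℂ,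
      HasDerivAt (fun s : ℂ => eval (matrixEntries (expGL (s • A))) F)
        (eval (matrixEntries (expGL (s • A))) (invariantField A F)) s := by
    intro F s
    have h := (hasStrictFDerivAt_eval F (matrixEntries (expGL (s • A)))).hasFDerivAt.comp_hasDerivAt
      s (hasDerivAt_matrixEntries_expGL A s)
    refine h.congr_deriv ?_
    rw [LinearMap.coe_toContinuousLinearMap']
    exact (eval_invariantField A (expGL (s • A) : Matrix (Fin n) (Fin n) ℂ) F).symm
  have hiter : ∀ (k : ℕ) (F : MvPolynomial (Fin n × Fin n) ℂ), F ∈ I →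
      iteratedDeriv k (fun s : ℂ => eval (matrixEntries (expGL (s • A))) F) 0 = 0 := by
    intro k
    induction k with
    | zero =>
      intro F hF
      rw [iteratedDeriv_zero, zero_smul, expGL_zero]
      exact mem_vanishingIdeal_iff_eval.1 hF _ ⟨1, G.one_mem, rfl⟩
    | succ k ih =>
      intro F hF
      rw [iteratedDeriv_succ', funext fun s => (hderiv F s).deriv]
      exact ih _ (invariantField_mem hv hF)
  have hzero : ∀ F ∈ I, ∀ s : ℂ, eval (matrixEntries (expGL (s • A))) F = 0 := by
    intro F hF s
    have h := Complex.taylorSeries_eq_of_entire (c := 0) (z := s)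
      (f := fun s : ℂ => eval (matrixEntries (expGL (s • A))) F)
      (fun s => (hderiv F s).differentiableAt)
    rw [← h]
    simp [hiter _ F hF]
  obtain ⟨J, hJ⟩ := hG
  rw [← SetLike.mem_coe, hJ]
  intro F hF
  refine hzero F (mem_vanishingIdeal_iff_eval.2 ?_) s
  rintro _ ⟨g, hg, rfl⟩
  rw [hJ] at hg
  exact hg F hF

end Exponential

/-! ### Covering a zero set near a point -/

section LocalImage

/-- If the derivative of `ψ` maps onto the kernel of the derivative of `f`, and `ψ` takes values
in the zeros of `f`, then `ψ` covers all zeros of `f` near its base point. -/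
theorem HasStrictFDerivAt.eventually_exists_eq_of_ker_le_range {E H F : Type*}
    [NormedAddCommGroup E] [NormedSpace ℝ E] [FiniteDimensional ℝ E]
    [NormedAddCommGroup H] [NormedSpace ℝ H] [FiniteDimensional ℝ H]
    [NormedAddCommGroup F] [NormedSpace ℝ F] [FiniteDimensional ℝ F]
    {ψ : E → H} {f : H → F} {ψ' : E →L[ℝ] H} {f' : H →L[ℝ] F} {a : E}
    (hψ : HasStrictFDerivAt ψ ψ' a) (hf : HasStrictFDerivAt f f' (ψ a))
    (hzero : ∀ v, f (ψ v) = 0) (hker : ∀ h, f' h = 0 → ∃ v, ψ' v = h)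
    {U : Set E} (hU : U ∈ nhds a) :
    ∀ᶠ h in nhds (ψ a), f h = 0 → ∃ v ∈ U, ψ v = h := by
  have : CompleteSpace E := FiniteDimensional.complete ℝ E
  have : CompleteSpace H := FiniteDimensional.complete ℝ H
  let T : Submodule ℝ H := LinearMap.ker (f' : H →ₗ[ℝ] F)
  have : CompleteSpace T := FiniteDimensional.complete ℝ T
  obtain ⟨q, hq⟩ := T.subtype.exists_leftInverse_of_injective (by simp)
  have hqT : ∀ h : T, q h = h := fun h => LinearMap.congr_fun hq h
  -- With `q` a projection onto `ker f'`, the pair `(q, f')` is injective, so `h ↦ (q h, f h)`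
  -- separates points near `ψ a`.
  obtain ⟨l, hl⟩ := (q.prod (f' : H →ₗ[ℝ] F)).exists_leftInverse_of_injective (by
    rw [LinearMap.ker_eq_bot']
    intro h hh
    obtain ⟨h1, h2⟩ := Prod.ext_iff.1 hh
    have h3 := hqT ⟨h, h2⟩
    rw [show q h = 0 from h1] at h3
    exact (congrArg Subtype.val h3).symm)
  let π : H →L[ℝ] T := LinearMap.toContinuousLinearMap q
  let L : T × F →L[ℝ] H := LinearMap.toContinuousLinearMap l
  have hk : HasStrictFDerivAt (fun h => L (π h, f h))
      ((ContinuousLinearEquiv.refl ℝ H : H ≃L[ℝ] H) : H →L[ℝ] H) (ψ a) := by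
    have h1 := L.hasStrictFDerivAt.comp (ψ a)
      ((π.hasStrictFDerivAt (x := ψ a)).prodMk hf)
    refine h1.congr_fderiv (ContinuousLinearMap.ext fun h => ?_)
    exact LinearMap.congr_fun hl h
  have hinj := hk.eventually_left_inverse
  have hπψ : HasStrictFDerivAt (fun v => π (ψ v)) (π.comp ψ') a :=
    π.hasStrictFDerivAt.comp a hψ
  -- `π ∘ ψ` is a submersion onto `T`; a zero `h` of `f` near `ψ a` thus shares both `π` and `f`
  -- with some `ψ v`, forcing `h = ψ v`.
  have hmap := hπψ.map_nhds_eq_of_surj (by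
    rw [LinearMap.range_eq_top]
    intro h
    obtain ⟨v, hv⟩ := hker h h.2
    exact ⟨v, (congrArg q hv).trans (hqT h)⟩)
  have hU' : U ∩ {v | hk.localInverse _ _ _ (L (π (ψ v), f (ψ v))) = ψ v} ∈ nhds a :=
    Filter.inter_mem hU (hψ.continuousAt.eventually hinj)
  have himg := Filter.image_mem_map (m := fun v => π (ψ v)) hU'
  rw [hmap] at himg
  filter_upwards [hinj, π.continuous.continuousAt.eventually himg] with h h1 h2 h3
  obtain ⟨v, ⟨hvU, hv⟩, hvh⟩ := h2
  refine ⟨v, hvU, ?_⟩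
  rw [← hv, ← h1, hzero, h3]
  exact congrArg (fun z => hk.localInverse _ _ _ (L (z, 0))) hvh

end LocalImage

/-! ### Conjugation on the group -/

section ComplexConjugation

variable {n m : ℕ}

theorem mem_range_ofReal_iff {z : ℂ} : z ∈ Set.range ((↑) : ℝ → ℂ) ↔ star z = z := by
  rw [← starRingEnd_apply, Complex.conj_eq_iff_real]
  exact ⟨fun ⟨r, hr⟩ => ⟨r, hr.symm⟩, fun ⟨r, hr⟩ => ⟨r, hr.symm⟩⟩

/-- Entrywise complex conjugation on the general linear group. -/
noncomputable def conjGL (g : GL (Fin n) ℂ) : GL (Fin n) ℂ :=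
  Matrix.GeneralLinearGroup.map (starRingEnd ℂ) g

theorem matrixEntries_conjGL (g : GL (Fin n) ℂ) :
    matrixEntries (conjGL g) = star (matrixEntries g) := by
  ext p
  simp [matrixEntries, conjGL]

theorem actionCoords_conjGL (g : GL (Fin n) ℂ) (x : Fin m → ℂ) :
    actionCoords (conjGL g) (star x) = star (actionCoords g x) := by
  ext i
  rcases i with i | _ | i
  · exact congrFun (matrixEntries_conjGL g) i
  · have h : ((conjGL g : GL (Fin n) ℂ) : Matrix (Fin n) (Fin n) ℂ).det =
        star (g : Matrix (Fin n) (Fin n) ℂ).det :=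
      (RingHom.map_det (starRingEnd ℂ) (g : Matrix (Fin n) (Fin n) ℂ)).symm
    simp [actionCoords, h]
  · simp [actionCoords]

theorem conjGL_mem {G : Subgroup (GL (Fin n) ℂ)} (hG : IsAlgebraicGroup G)
    (hGreal : IsDefinedOverReal (matrixEntries '' (G : Set (GL (Fin n) ℂ))))
    {g : GL (Fin n) ℂ} (hg : g ∈ G) : conjGL g ∈ G := by
  obtain ⟨I, hI⟩ := hG
  obtain ⟨J, hJ⟩ := hGreal
  have hspan : vanishingIdeal ℂ (matrixEntries '' (G : Set (GL (Fin n) ℂ))) ≤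
      RingHom.ker (eval (matrixEntries (conjGL g))) := by
    rw [hJ, Ideal.span_le]
    rintro _ ⟨p, hp, rfl⟩
    have h1 : map (algebraMap ℝ ℂ) p ∈
        vanishingIdeal ℂ (matrixEntries '' (G : Set (GL (Fin n) ℂ))) := by
      rw [hJ]
      exact Ideal.subset_span ⟨p, hp, rfl⟩
    rw [SetLike.mem_coe, RingHom.mem_ker, ← map_conj_map_ofReal, matrixEntries_conjGL,
      eval_star_map_conj, mem_vanishingIdeal_iff_eval.1 h1 _ ⟨g, hg, rfl⟩, map_zero]
  rw [← SetLike.mem_coe, hI]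
  intro F hF
  refine hspan (mem_vanishingIdeal_iff_eval.2 ?_)
  rintro _ ⟨g', hg', rfl⟩
  rw [hI] at hg'
  exact hg' F hF

theorem star_mem_groupCoords {G : Subgroup (GL (Fin n) ℂ)} (hG : IsAlgebraicGroup G)
    (hGreal : IsDefinedOverReal (matrixEntries '' (G : Set (GL (Fin n) ℂ))))
    {x : Fin m → ℂ} (hx : star x = x) :
    ∀ p ∈ groupCoords G x, star p ∈ groupCoords G x := by
  rintro _ ⟨g, rfl⟩
  refine ⟨⟨conjGL (g : GL (Fin n) ℂ), conjGL_mem hG hGreal g.2⟩, ?_⟩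
  change actionCoords (conjGL (g : GL (Fin n) ℂ)) x = _
  rw [← actionCoords_conjGL, hx]

/-- The exponential commutes with both transpose and conjugate transpose, which agree on real
matrices. -/
theorem star_matrixEntries_expGL {A : Matrix (Fin n) (Fin n) ℂ} (hA : ∀ i j, star (A i j) = A i j) :
    star (matrixEntries (expGL A)) = matrixEntries (expGL A) := by
  have h1 : Aᴴ = Aᵀ := by
    ext i j
    exact hA j i
  have h2 : (NormedSpace.exp A)ᴴ = (NormedSpace.exp A)ᵀ := by
    rw [← Matrix.exp_conjTranspose, ← Matrix.exp_transpose, h1]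
  ext p
  exact congrFun (congrFun h2 p.2) p.1

theorem star_matrixEntries_mul {g h : GL (Fin n) ℂ} (hg : star (matrixEntries g) = matrixEntries g)
    (hh : star (matrixEntries h) = matrixEntries h) :
    star (matrixEntries (g * h)) = matrixEntries (g * h) := by
  ext p
  have h1 := fun p => congrFun hg p
  have h2 := fun p => congrFun hh p
  simp only [matrixEntries, Pi.star_apply] at h1 h2
  simp only [matrixEntries, Pi.star_apply, Units.val_mul, Matrix.mul_apply, star_sum, star_mul']
  exact Finset.sum_congr rfl fun k _ => by rw [h1 (p.1, k), h2 (k, p.2)]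

theorem mem_groupRealPoints_iff {G : Subgroup (GL (Fin n) ℂ)} {g : G} :
    g ∈ groupRealPoints G ↔
      star (matrixEntries (g : GL (Fin n) ℂ)) = matrixEntries (g : GL (Fin n) ℂ) := by
  rw [funext_iff]
  exact forall_congr' fun p => mem_range_ofReal_iff

end ComplexConjugation

/-! ### The exponential in group coordinates -/

section ExponentialCoordinates

variable {n m : ℕ}

/-- The equation `det * det⁻¹ = 1` and the constancy of `x` determine the remaining components of a
tangent vector. -/
theorem eq_zero_of_mem_zariskiTangent_groupCoords {G : Subgroup (GL (Fin n) ℂ)} {x : Fin m → ℂ}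
    {v : (Fin n × Fin n) ⊕ (Unit ⊕ Fin m) → ℂ}
    (hv : v ∈ zariskiTangent (groupCoords G x) (actionCoords 1 x))
    (h0 : ∀ p, v (Sum.inl p) = 0) : v = 0 := by
  rw [mem_zariskiTangent] at hv
  have hinl : v ∘ Sum.inl = 0 := funext h0
  ext i
  rcases i with i | _ | i
  · exact h0 i
  · have h1 := hv (rename Sum.inl (detPolynomial n) * X (Sum.inr (Sum.inl ())) - C 1) (by
      rw [mem_vanishingIdeal_iff_eval]
      rintro _ ⟨g, rfl⟩
      rw [map_sub, map_mul, eval_rename, eval_X, eval_C,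
        show actionCoords (g : GL (Fin n) ℂ) x ∘ Sum.inl = matrixEntries g from rfl,
        eval_detPolynomial]
      simp [actionCoords, det_ne_zero])
    rw [differential_sub, differential_C, differential_mul, differential_rename_inl, hinl, map_zero, eval_rename,
      show actionCoords (1 : GL (Fin n) ℂ) x ∘ Sum.inl = matrixEntries 1 from rfl,
      eval_detPolynomial] at h1
    simpa using h1
  · have h1 := hv (X (Sum.inr (Sum.inr i)) - C (x i)) (by
      rw [mem_vanishingIdeal_iff_eval]
      rintro _ ⟨g, rfl⟩
      simp [actionCoords])
    simpa using h1

attribute [local instance] Matrix.linftyOpNormedRing Matrix.linftyOpNormedAlgebra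

theorem hasStrictFDerivAt_matrixEntries_expGL :
    HasStrictFDerivAt (fun A : Matrix (Fin n) (Fin n) ℂ => matrixEntries (expGL A))
      (entriesCLM n) 0 := by
  have h : HasStrictFDerivAt (NormedSpace.exp : Matrix (Fin n) (Fin n) ℂ → _) (1 : _ →L[ℂ] _) 0 :=
    hasStrictFDerivAt_exp_zero
  exact (entriesCLM n).hasStrictFDerivAt.comp 0 h

theorem exists_hasStrictFDerivAt_actionCoords_expGL (x : Fin m → ℂ) :
    ∃ C : Matrix (Fin n) (Fin n) ℂ →L[ℂ] ((Fin n × Fin n) ⊕ (Unit ⊕ Fin m) → ℂ),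
      HasStrictFDerivAt (fun A : Matrix (Fin n) (Fin n) ℂ => actionCoords (expGL A) x) C 0 ∧
      ∀ A p, C A (Sum.inl p) = A p.1 p.2 := by
  have hentries := hasStrictFDerivAt_matrixEntries_expGL (n := n)
  have h : ∀ i, ∃ Ci : Matrix (Fin n) (Fin n) ℂ →L[ℂ] ℂ,
      HasStrictFDerivAt (fun A : Matrix (Fin n) (Fin n) ℂ => actionCoords (expGL A) x i) Ci 0 ∧
      ∀ A p, i = Sum.inl p → Ci A = A p.1 p.2 := by
    rintro (p | _ | i)
    · refine ⟨(ContinuousLinearMap.proj p).comp (entriesCLM n),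
        hasStrictFDerivAt_pi'.1 hentries p, ?_⟩
      rintro A q hq
      obtain rfl := Sum.inl_injective hq
      rfl
    · have h1 := (hasStrictFDerivAt_eval (detPolynomial n) _).comp 0 hentries
      have h2 := (hasStrictDerivAt_inv (det_ne_zero (expGL 0))).comp_hasStrictFDerivAt_of_eq
        (0 : Matrix (Fin n) (Fin n) ℂ) h1 (eval_detPolynomial _).symm
      refine ⟨_, h2.congr_of_eventuallyEq (Filter.Eventually.of_forall fun A => ?_), by simp⟩
      simp [actionCoords, eval_detPolynomial]
    · exact ⟨0, hasStrictFDerivAt_const (x i) _, by simp⟩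
  choose C hC hC' using h
  refine ⟨ContinuousLinearMap.pi C, hasStrictFDerivAt_pi.2 hC, fun A p => hC' _ A p rfl⟩

theorem continuous_expGL : Continuous (expGL : Matrix (Fin n) (Fin n) ℂ → GL (Fin n) ℂ) := by
  have h : Continuous (NormedSpace.exp : Matrix (Fin n) (Fin n) ℂ → _) :=
    NormedSpace.exp_continuous
  exact Units.continuous_iff.2 ⟨h, h.comp continuous_neg⟩

end ExponentialCoordinates

/-! ### Tangent spaces from generators, and Zariski closures -/

section Tangent

theorem MvPolynomial.mem_zariskiTangent_of_span {k σ : Type*} [Field k] [Fintype σ]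
    {S : Set (σ → k)} {p v : σ → k} (hp : p ∈ S) {B : Set (MvPolynomial σ k)}
    (hB : Ideal.span B = vanishingIdeal k S) (h : ∀ f ∈ B, differential f p v = 0) :
    v ∈ zariskiTangent S p := by
  rw [mem_zariskiTangent]
  intro f hf
  rw [← hB] at hf
  induction hf using Submodule.span_induction with
  | mem f hf => exact h f hf
  | zero => simpa using differential_C (0 : k) p v
  | add f g _ _ hf hg => rw [differential_add, hf, hg, add_zero]
  | smul a f hf ih =>
    have hf' : f ∈ vanishingIdeal k S := hB ▸ hf
    rw [smul_eq_mul, differential_mul, ih, mem_vanishingIdeal_iff_eval.1 hf' p hp, mul_zero,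
      zero_mul, add_zero]

theorem eval_eq_zero_of_mem_zariskiClosure {σ : Type*} {S : Set (σ → ℂ)} {f : MvPolynomial σ ℂ}
    (hf : f ∈ vanishingIdeal ℂ S) {z : σ → ℂ} (hz : z ∈ zariskiClosure S) : eval z f = 0 := by
  have h := Set.mem_sInter.1 hz {x | eval x f = 0}
    ⟨⟨{f}, by simp⟩, fun x hx => mem_vanishingIdeal_iff_eval.1 hf x hx⟩
  exact h

theorem vanishingIdeal_zariskiClosure {σ : Type*} (S : Set (σ → ℂ)) :
    vanishingIdeal ℂ (zariskiClosure S) = vanishingIdeal ℂ S := by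
  refine le_antisymm (vanishingIdeal_anti_mono (subset_zariskiClosure S)) fun f hf => ?_
  exact mem_vanishingIdeal_iff_eval.2 fun z hz => eval_eq_zero_of_mem_zariskiClosure hf hz

end Tangent

/-! ### The orbit map as a submersion -/

section RealAction

variable {n m : ℕ} {G : Subgroup (GL (Fin n) ℂ)} {X : Set (Fin m → ℂ)} [MulAction G X]

/-- The action is given by the polynomials `φ`, which have real coefficients. -/
def IsActionPolynomial (G : Subgroup (GL (Fin n) ℂ)) (X : Set (Fin m → ℂ)) [MulAction G X]
    (φ : Fin m → MvPolynomial ((Fin n × Fin n) ⊕ (Unit ⊕ Fin m)) ℂ) : Prop :=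
  (∀ j, map (starRingEnd ℂ) (φ j) = φ j) ∧
  ∀ (g : G) (z : X), polyMap φ (actionCoords (g : GL (Fin n) ℂ) (z : Fin m → ℂ)) =
    ((g • z : X) : Fin m → ℂ)

theorem IsRealPolynomialAction.exists_isActionPolynomial (hact : IsRealPolynomialAction G X) :
    ∃ φ, IsActionPolynomial G X φ := by
  obtain ⟨P, hP⟩ := hact
  refine ⟨fun j => map (algebraMap ℝ ℂ) (P j), fun j => map_conj_map_ofReal _, fun g z => ?_⟩
  ext i
  rw [hP, polyMap, eval_map, aeval_def]

/-- The orbit of `x` as a subset of affine space. -/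
def orbitSet (G : Subgroup (GL (Fin n) ℂ)) {X : Set (Fin m → ℂ)} [MulAction G X] (x : X) :
    Set (Fin m → ℂ) :=
  (fun z : X => (z : Fin m → ℂ)) '' MulAction.orbit G x

theorem smul_mem_orbitSet (x : X) (g : G) : ((g • x : X) : Fin m → ℂ) ∈ orbitSet G x :=
  ⟨g • x, ⟨g, rfl⟩, rfl⟩

theorem orbitSet_smul (x : X) (g : G) : orbitSet G (g • x) = orbitSet G x := by
  rw [orbitSet, MulAction.orbit_smul, orbitSet]

variable {φ : Fin m → MvPolynomial ((Fin n × Fin n) ⊕ (Unit ⊕ Fin m)) ℂ}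

theorem IsActionPolynomial.image_groupCoords (hφ : IsActionPolynomial G X φ) (x : X) :
    polyMap φ '' groupCoords G x = orbitSet G x := by
  ext z
  constructor
  · rintro ⟨_, ⟨g, rfl⟩, rfl⟩
    rw [hφ.2]
    exact smul_mem_orbitSet x g
  · rintro ⟨_, ⟨g, rfl⟩, rfl⟩
    exact ⟨_, ⟨g, rfl⟩, hφ.2 g x⟩

theorem IsActionPolynomial.star_polyMap (hφ : IsActionPolynomial G X φ)
    (p : (Fin n × Fin n) ⊕ (Unit ⊕ Fin m) → ℂ) : star (polyMap φ p) = polyMap φ (star p) := by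
  ext j
  simp only [polyMap]
  rw [← hφ.1 j, eval_star_map_conj, Pi.star_apply, polyMap]
  rfl

theorem IsActionPolynomial.star_polyMapDifferential (hφ : IsActionPolynomial G X φ)
    (p v : (Fin n × Fin n) ⊕ (Unit ⊕ Fin m) → ℂ) :
    star (polyMapDifferential φ p v) = polyMapDifferential φ (star p) (star v) := by
  ext j
  rw [polyMapDifferential_apply, ← hφ.1 j, differential_star_map_conj]
  rfl

theorem IsActionPolynomial.star_mem_orbitSet (hφ : IsActionPolynomial G X φ)
    (hG : IsAlgebraicGroup G)
    (hGreal : IsDefinedOverReal (matrixEntries '' (G : Set (GL (Fin n) ℂ))))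
    {x : X} (hx : star (x : Fin m → ℂ) = x) : ∀ z ∈ orbitSet G x, star z ∈ orbitSet G x := by
  rw [← hφ.image_groupCoords]
  rintro _ ⟨p, hp, rfl⟩
  exact ⟨star p, star_mem_groupCoords hG hGreal hx p hp, (hφ.star_polyMap p).symm⟩

/-- The polynomial map `z ↦ h • z`. -/
noncomputable def actionBy (φ : Fin m → MvPolynomial ((Fin n × Fin n) ⊕ (Unit ⊕ Fin m)) ℂ)
    (h : GL (Fin n) ℂ) : Fin m → MvPolynomial (Fin m) ℂ :=
  fun j => bind₁ (Sum.elim (fun p => C (matrixEntries h p))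
    (Sum.elim (fun _ => C (h : Matrix (Fin n) (Fin n) ℂ).det⁻¹) MvPolynomial.X)) (φ j)

theorem polyMap_actionBy (h : GL (Fin n) ℂ) (z : Fin m → ℂ) :
    polyMap (actionBy φ h) z = polyMap φ (actionCoords h z) := by
  refine (polyMap_bind₁ _ _ z).trans ?_
  congr 1
  ext i
  rcases i with i | _ | i <;> simp [polyMap, actionCoords]

theorem IsActionPolynomial.polyMap_actionBy (hφ : IsActionPolynomial G X φ) (h : G) (z : X) :
    polyMap (actionBy φ h) z = ((h • z : X) : Fin m → ℂ) := by
  rw [_root_.polyMap_actionBy, hφ.2]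

theorem IsActionPolynomial.mapsTo_actionBy (hφ : IsActionPolynomial G X φ) (h : G) (x : X) :
    Set.MapsTo (polyMap (actionBy φ h)) (orbitSet G x) (orbitSet G x) := by
  rintro _ ⟨_, ⟨g, rfl⟩, rfl⟩
  simp only [hφ.polyMap_actionBy, smul_smul]
  exact smul_mem_orbitSet x (h * g)

/-- The orbit map is a submersion at the identity. -/
theorem IsActionPolynomial.exists_polyMapDifferential_eq (hφ : IsActionPolynomial G X φ)
    (hG : IsAlgebraicGroup G) (hGirr : IsIrreducibleGroup G) (x : X) {w : Fin m → ℂ}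
    (hw : w ∈ zariskiTangent (orbitSet G x) x) :
    ∃ v ∈ zariskiTangent (groupCoords G (x : Fin m → ℂ)) (actionCoords 1 (x : Fin m → ℂ)),
      polyMapDifferential φ (actionCoords 1 (x : Fin m → ℂ)) v = w := by
  obtain ⟨_, ⟨g, rfl⟩, hg⟩ := exists_differential_surjOn
    (vanishingIdeal_groupCoords_isPrime hG hGirr (x : Fin m → ℂ)) φ
  rw [hφ.image_groupCoords] at hg
  simp only [hφ.2] at hg
  -- Push `w` to the good point `g • x`, lift it there, and translate the lift back by `g⁻¹`.
  have hw' := polyMapDifferential_mem_zariskiTangent (hφ.mapsTo_actionBy g x) hw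
  rw [hφ.polyMap_actionBy] at hw'
  obtain ⟨v, hv, hvw⟩ := hg _ hw'
  have hv' := polyMapDifferential_mem_zariskiTangent (mapsTo_leftTranslation (g⁻¹).2 _) hv
  rw [polyMap_leftTranslation] at hv'
  have h1 : ((g⁻¹ : G) : GL (Fin n) ℂ) * (g : GL (Fin n) ℂ) = 1 := by simp
  rw [h1] at hv'
  refine ⟨_, hv', ?_⟩
  -- Equivariance `(g⁻¹ k) • x = g⁻¹ • (k • x)`, valid for `k ∈ G`, is differentiated along the
  -- lift.
  have h2 : Set.EqOn (polyMap fun j => bind₁ (leftTranslation ((g⁻¹ : G) : GL (Fin n) ℂ)) (φ j))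
      (polyMap fun j => bind₁ φ (actionBy φ ((g⁻¹ : G) : GL (Fin n) ℂ) j))
      (groupCoords G (x : Fin m → ℂ)) := by
    rintro _ ⟨k, rfl⟩
    rw [polyMap_bind₁, polyMap_bind₁, polyMap_leftTranslation, hφ.2, hφ.polyMap_actionBy]
    have h3 := hφ.2 (g⁻¹ * k) x
    rw [mul_smul] at h3
    exact h3
  have h3 := polyMapDifferential_eq_of_eqOn h2 hv
  rw [polyMapDifferential_bind₁, polyMapDifferential_bind₁, polyMap_leftTranslation, h1,
    hφ.2] at h3
  rw [h3, show polyMapDifferential φ _ v = _ from funext hvw]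
  have h4 : Set.EqOn (polyMap fun j => bind₁ (actionBy φ (g : GL (Fin n) ℂ))
      (actionBy φ ((g⁻¹ : G) : GL (Fin n) ℂ) j)) (polyMap MvPolynomial.X) (orbitSet G x) := by
    rintro _ ⟨z, -, rfl⟩
    simp only [polyMap_bind₁, hφ.polyMap_actionBy, inv_smul_smul]
    ext j
    simp [polyMap]
  have h5 := polyMapDifferential_eq_of_eqOn h4 hw
  rw [polyMapDifferential_bind₁, hφ.polyMap_actionBy] at h5
  rw [h5]
  ext j
  simp

end RealAction

/-! ### Real orbits near a real point -/

section RealOrbit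

variable {n m : ℕ} {G : Subgroup (GL (Fin n) ℂ)} {X : Set (Fin m → ℂ)} [MulAction G X]
  {φ : Fin m → MvPolynomial ((Fin n × Fin n) ⊕ (Unit ⊕ Fin m)) ℂ}

/-- The real Lie algebra of `G`, in the coordinates `(g, det(g)⁻¹, x)`. -/
noncomputable def realTangent (G : Subgroup (GL (Fin n) ℂ)) (x : Fin m → ℂ) :
    Submodule ℝ ((Fin n × Fin n) ⊕ (Unit ⊕ Fin m) → ℂ) where
  carrier := {v | v ∈ zariskiTangent (groupCoords G x) (actionCoords 1 x) ∧ star v = v}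
  add_mem' := fun ha hb => ⟨add_mem ha.1 hb.1, by rw [star_add, ha.2, hb.2]⟩
  zero_mem' := ⟨zero_mem _, star_zero _⟩
  smul_mem' := fun r v hv => ⟨by
    rw [← Complex.coe_smul]
    exact Submodule.smul_mem _ _ hv.1, by rw [star_smul, hv.2, star_trivial]⟩

/-- The inclusion of real affine space into complex affine space. -/
noncomputable def ofRealCLM (σ : Type*) [Fintype σ] : (σ → ℝ) →L[ℝ] (σ → ℂ) :=
  ContinuousLinearMap.pi fun i => Complex.ofRealCLM.comp (ContinuousLinearMap.proj i)

/-- The real part map on complex affine space. -/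
noncomputable def rePiCLM (σ : Type*) [Fintype σ] : (σ → ℂ) →L[ℝ] (σ → ℝ) :=
  ContinuousLinearMap.pi fun i => Complex.reCLM.comp (ContinuousLinearMap.proj i)

theorem rePiCLM_ofRealCLM {σ : Type*} [Fintype σ] (η : σ → ℝ) : rePiCLM σ (ofRealCLM σ η) = η :=
  rfl

theorem ofRealCLM_rePiCLM {σ : Type*} [Fintype σ] {z : σ → ℂ} (hz : star z = z) :
    ofRealCLM σ (rePiCLM σ z) = z := by
  ext i
  exact Complex.conj_eq_iff_re.1 (congrFun hz i)

theorem star_ofRealCLM {σ : Type*} [Fintype σ] (η : σ → ℝ) :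
    star (ofRealCLM σ η) = ofRealCLM σ η := by
  ext i
  exact Complex.conj_ofReal (η i)

/-- A real vector tangent to the orbit at a real point is the image of a real tangent vector. -/
theorem IsActionPolynomial.exists_realTangent (hφ : IsActionPolynomial G X φ)
    (hG : IsAlgebraicGroup G) (hGirr : IsIrreducibleGroup G)
    (hGreal : IsDefinedOverReal (matrixEntries '' (G : Set (GL (Fin n) ℂ))))
    {x : X} (hx : star (x : Fin m → ℂ) = x) {w : Fin m → ℂ} (hws : star w = w)
    (hw : w ∈ zariskiTangent (orbitSet G x) x) :
    ∃ v ∈ realTangent G (x : Fin m → ℂ),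
      polyMapDifferential φ (actionCoords 1 (x : Fin m → ℂ)) v = w := by
  obtain ⟨v, hv, hvw⟩ := hφ.exists_polyMapDifferential_eq hG hGirr x hw
  have h1 : star (actionCoords (1 : GL (Fin n) ℂ) (x : Fin m → ℂ)) = actionCoords 1 x := by
    rw [← actionCoords_conjGL, hx, conjGL, map_one]
  have hv' := star_mem_zariskiTangent (star_mem_groupCoords hG hGreal hx) hv
  have hvw' := hφ.star_polyMapDifferential (actionCoords 1 (x : Fin m → ℂ)) v
  rw [h1] at hv' hvw'
  rw [hvw, hws] at hvw'
  -- Since `w` and `φ` are real, `star v` is also a lift of `w`; the average is a real lift.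
  refine ⟨(1 / 2 : ℂ) • (v + star v), ⟨Submodule.smul_mem _ _ (add_mem hv hv'), ?_⟩, ?_⟩
  · simp [star_smul, add_comm]
  · rw [map_smul, map_add, hvw, ← hvw', ← two_smul ℂ, smul_smul]
    norm_num

attribute [local instance] Matrix.linftyOpNormedRing Matrix.linftyOpNormedAlgebra

/-- The matrix part of a tangent vector, as a continuous linear map. -/
noncomputable def matrixPartCLM (n m : ℕ) :
    ((Fin n × Fin n) ⊕ (Unit ⊕ Fin m) → ℂ) →L[ℂ] Matrix (Fin n) (Fin n) ℂ :=
  LinearMap.toContinuousLinearMap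
    { toFun := matrixPart
      map_add' := fun _ _ => rfl
      map_smul' := fun _ _ => rfl }

/-- Near a real point, every real point of the orbit closure is the translate by a real group
element near the identity. -/
theorem IsActionPolynomial.exists_mem_nhds (hφ : IsActionPolynomial G X φ)
    (hG : IsAlgebraicGroup G) (hGirr : IsIrreducibleGroup G)
    (hGreal : IsDefinedOverReal (matrixEntries '' (G : Set (GL (Fin n) ℂ))))
    {x : X} (hx : star (x : Fin m → ℂ) = x) {U : Set (GL (Fin n) ℂ)} (hU : U ∈ nhds 1) :
    ∃ V ∈ nhds (x : Fin m → ℂ), ∀ y ∈ V, y ∈ realPoints (zariskiClosure (orbitSet G x)) →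
      ∃ g : G, g ∈ groupRealPoints G ∧ (g : GL (Fin n) ℂ) ∈ U ∧ ((g • x : X) : Fin m → ℂ) = y := by
  -- Finitely many equations suffice, so the map `f` below has a finite-dimensional target.
  obtain ⟨B, hB⟩ := (isNoetherianRing_iff_ideal_fg _).1 inferInstance
    (vanishingIdeal ℂ (orbitSet G x))
  have hxO : (x : Fin m → ℂ) ∈ orbitSet G x := by
    simpa using smul_mem_orbitSet x (1 : G)
  obtain ⟨D, hD, hDentry⟩ := exists_hasStrictFDerivAt_actionCoords_expGL (n := n) (x : Fin m → ℂ)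
  let E := realTangent G (x : Fin m → ℂ)
  let γ : Matrix (Fin n) (Fin n) ℂ → (Fin m → ℂ) :=
    fun A => polyMap φ (actionCoords (expGL A) (x : Fin m → ℂ))
  let M : E →L[ℝ] Matrix (Fin n) (Fin n) ℂ :=
    ((matrixPartCLM n m).restrictScalars ℝ).comp E.subtypeL
  have hMmem : ∀ (v : E) (s : ℂ), expGL (s • M v) ∈ G := fun v s => expGL_smul_mem hG v.2.1 s
  have hMmem1 : ∀ v : E, expGL (M v) ∈ G := fun v => by simpa using hMmem v 1
  have hMreal : ∀ v : E, star (matrixEntries (expGL (M v))) = matrixEntries (expGL (M v)) :=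
    fun v => star_matrixEntries_expGL fun i j => congrFun v.2.2 (Sum.inl (i, j))
  -- Both sides are tangent at 1, the left one as the velocity of `exp (s • M v)`, and their matrix
  -- parts agree.
  have hMD : ∀ v : E, D (M v) = v := by
    intro v
    have h1 : HasDerivAt (fun s : ℂ => actionCoords (expGL (s • M v)) (x : Fin m → ℂ))
        (D (M v)) 0 := by
      have h2 : HasDerivAt (fun s : ℂ => s • M v) (M v) 0 := by
        have h := (hasDerivAt_id (0 : ℂ)).smul_const (M v)
        rw [one_smul] at h
        exact h
      exact hD.hasFDerivAt.comp_hasDerivAt_of_eq 0 h2 (by simp)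
    have h3 := deriv_mem_zariskiTangent (S := groupCoords G (x : Fin m → ℂ)) h1
      fun s => ⟨⟨_, hMmem v s⟩, rfl⟩
    simp only [zero_smul, expGL_zero] at h3
    have h4 := eq_zero_of_mem_zariskiTangent_groupCoords (sub_mem h3 v.2.1) fun p => by
      rw [Pi.sub_apply, hDentry]
      exact sub_self _
    exact sub_eq_zero.1 h4
  have hγx : γ (M 0) = x := by
    have h := hφ.2 (1 : G) x
    simpa [γ, expGL_zero] using h
  let ψ : E → (Fin m → ℝ) := fun v => rePiCLM (Fin m) (γ (M v))
  have hγsmul : ∀ v : E, γ (M v) = (((⟨_, hMmem1 v⟩ : G) • x : X) : Fin m → ℂ) :=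
    fun v => hφ.2 ⟨_, hMmem1 v⟩ x
  have hγstar : ∀ v : E, star (γ (M v)) = γ (M v) := by
    intro v
    have h : conjGL (expGL (M v)) = expGL (M v) := by
      ext i j
      have := (matrixEntries_conjGL (expGL (M v))).trans (hMreal v)
      exact congrFun this (i, j)
    simp only [γ]
    rw [hφ.star_polyMap, ← actionCoords_conjGL, hx, h]
  have hψγ : ∀ v : E, ofRealCLM (Fin m) (ψ v) = γ (M v) := fun v => ofRealCLM_rePiCLM (hγstar v)
  let dφ : ((Fin n × Fin n) ⊕ (Unit ⊕ Fin m) → ℂ) →L[ℂ] (Fin m → ℂ) :=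
    LinearMap.toContinuousLinearMap (polyMapDifferential φ (actionCoords 1 (x : Fin m → ℂ)))
  have hγ : HasStrictFDerivAt γ (dφ.comp D) (M 0) := by
    rw [map_zero]
    have h : HasStrictFDerivAt (polyMap φ) dφ (actionCoords (expGL 0) (x : Fin m → ℂ)) := by
      rw [expGL_zero]
      exact hasStrictFDerivAt_polyMap φ _
    exact h.comp 0 hD
  have hψ : HasStrictFDerivAt ψ
      ((rePiCLM (Fin m)).comp (((dφ.comp D).restrictScalars ℝ).comp M)) 0 :=
    (rePiCLM (Fin m)).hasStrictFDerivAt.comp 0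
      ((hγ.restrictScalars ℝ).comp 0 M.hasStrictFDerivAt)
  let β : B → MvPolynomial (Fin m) ℂ := fun b => b.1
  let f : (Fin m → ℝ) → (B → ℂ) := fun η => polyMap β (ofRealCLM (Fin m) η)
  have hψ0 : ofRealCLM (Fin m) (ψ 0) = x := (hψγ 0).trans hγx
  have hf : HasStrictFDerivAt f
      (((LinearMap.toContinuousLinearMap
        (polyMapDifferential β (x : Fin m → ℂ))).restrictScalars ℝ).comp (ofRealCLM (Fin m)))
      (ψ 0) := by
    have h := (hasStrictFDerivAt_polyMap β (x : Fin m → ℂ)).restrictScalars ℝ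
    rw [← hψ0] at h ⊢
    exact h.comp (ψ 0) (ofRealCLM (Fin m)).hasStrictFDerivAt
  have hBmem : ∀ b : B, β b ∈ vanishingIdeal ℂ (orbitSet G x) :=
    fun b => hB ▸ Ideal.subset_span b.2
  have hzero : ∀ v, f (ψ v) = 0 := by
    intro v
    ext b
    simp only [f]
    rw [hψγ, hγsmul]
    exact mem_vanishingIdeal_iff_eval.1 (hBmem b) _ (smul_mem_orbitSet x _)
  have hev := hψ.eventually_exists_eq_of_ker_le_range hf hzero (fun η hη => ?_)
    (U := {v | expGL (M v) ∈ U}) ?_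
  · refine ⟨rePiCLM (Fin m) ⁻¹' {η | f η = 0 → ∃ v ∈ {v | expGL (M v) ∈ U}, ψ v = η}, ?_, ?_⟩
    · refine (rePiCLM (Fin m)).continuous.continuousAt.preimage_mem_nhds ?_
      rw [← hψ0, rePiCLM_ofRealCLM]
      exact hev
    · intro y hyV hy
      have hys : star y = y := funext fun i => mem_range_ofReal_iff.1 (hy.2 i)
      obtain ⟨v, hvU, hv⟩ := hyV (by
        ext b
        simp only [f]
        rw [ofRealCLM_rePiCLM hys]
        exact eval_eq_zero_of_mem_zariskiClosure (hBmem b) hy.1)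
      refine ⟨⟨_, hMmem1 v⟩, mem_groupRealPoints_iff.2 (hMreal v), hvU, ?_⟩
      rw [← hγsmul, ← hψγ, hv, ofRealCLM_rePiCLM hys]
  · have hw : ofRealCLM (Fin m) η ∈ zariskiTangent (orbitSet G x) x :=
      mem_zariskiTangent_of_span hxO hB fun b hb => congrFun hη ⟨b, hb⟩
    obtain ⟨v, hv, hvw⟩ := hφ.exists_realTangent hG hGirr hGreal hx (star_ofRealCLM η) hw
    refine ⟨⟨v, hv⟩, ?_⟩
    change rePiCLM (Fin m) (dφ (D (M ⟨v, hv⟩))) = η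
    rw [hMD]
    change rePiCLM (Fin m) (polyMapDifferential φ _ v) = η
    rw [hvw, rePiCLM_ofRealCLM]
  · refine (continuous_expGL.comp M.continuous).continuousAt.preimage_mem_nhds ?_
    simpa [expGL_zero] using hU

end RealOrbit

/-! ### Conclusion -/

theorem isDefinedOverReal_orbitClosure {n m : ℕ} {G : Subgroup (GL (Fin n) ℂ)}
    (hG : IsAlgebraicGroup G)
    (hGreal : IsDefinedOverReal (matrixEntries '' (G : Set (GL (Fin n) ℂ))))
    {X : Set (Fin m → ℂ)} [MulAction G X] (hact : IsRealPolynomialAction G X)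
    {x : X} (hx : star (x : Fin m → ℂ) = x) : IsDefinedOverReal (orbitClosure G x) := by
  obtain ⟨φ, hφ⟩ := hact.exists_isActionPolynomial
  refine exists_eq_span_map_of_conj_mem _ fun f hf => ?_
  rw [orbitClosure, vanishingIdeal_zariskiClosure] at hf ⊢
  exact map_conj_mem_vanishingIdeal (hφ.star_mem_orbitSet hG hGreal hx) hf

theorem mainTheorem10 {n m : ℕ} (G : Subgroup (GL (Fin n) ℂ))
    (hG : IsAlgebraicGroup G) (hGirr : IsIrreducibleGroup G)
    (hGreal : IsDefinedOverReal (matrixEntries '' (G : Set (GL (Fin n) ℂ))))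
    (X : Set (Fin m → ℂ)) (hX : IsZariskiClosed X) (hXreal : IsDefinedOverReal X)
    [MulAction G X] (hact : IsRealPolynomialAction G X)
    (x : X) (hx : (x : Fin m → ℂ) ∈ realPoints X) :
    IsDefinedOverReal (orbitClosure G x) ∧ IsOpenMap (realOrbitMap hact x hx) := by
  have hxs : star (x : Fin m → ℂ) = x := funext fun i => mem_range_ofReal_iff.1 (hx.2 i)
  refine ⟨isDefinedOverReal_orbitClosure hG hGreal hact hxs, ?_⟩
  obtain ⟨φ, hφ⟩ := hact.exists_isActionPolynomial
  rw [isOpenMap_iff_nhds_le]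
  intro g S hS
  obtain ⟨W, hW, hWS⟩ := mem_nhds_subtype _ _ _ |>.1 hS
  obtain ⟨W', hW', hWW'⟩ := mem_nhds_subtype _ _ _ |>.1 hW
  -- The local result is applied at `g • x`, whose orbit is that of `x`; right multiplication by `g`
  -- converts neighbourhoods of `g` to neighbourhoods of 1.
  have hU : {u : GL (Fin n) ℂ | u * (g : G) ∈ W'} ∈ nhds (1 : GL (Fin n) ℂ) := by
    refine (continuous_mul_const ((g : G) : GL (Fin n) ℂ)).continuousAt.preimage_mem_nhds ?_
    rwa [one_mul]
  have hgx := (realOrbitMap hact x hx g).2.2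
  obtain ⟨V, hV, hVU⟩ := hφ.exists_mem_nhds hG hGirr hGreal (x := (g : G) • x)
    (funext fun i => mem_range_ofReal_iff.1 (hgx i)) hU
  rw [orbitSet_smul] at hVU
  refine (mem_nhds_subtype _ _ _).2 ⟨V, hV, fun y hy => ?_⟩
  obtain ⟨u, hu, huW, huy⟩ := hVU y hy y.2
  have hug : u * (g : G) ∈ groupRealPoints G :=
    mem_groupRealPoints_iff.2 (star_matrixEntries_mul (mem_groupRealPoints_iff.1 hu)
      (mem_groupRealPoints_iff.1 g.2))
  have hmem : realOrbitMap hact x hx ⟨u * (g : G), hug⟩ ∈ S :=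
    hWS (hWW' huW : (⟨u * (g : G), hug⟩ : groupRealPoints G).1 ∈ W)
  have heq : realOrbitMap hact x hx ⟨u * (g : G), hug⟩ = y := by
    apply Subtype.ext
    rw [← huy, smul_smul]
    rfl
  rwa [heq] at hmem
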